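/- All manifolds are smooth and without boundary. A \emph{singular metric} on an $n$-dimensional manifold $M$ is a smooth symmetric $(0,2)$-tensor field $g=\langle\cdot,\cdot\rangle$, possibly degenerate and of possibly variable signature. Let $v^\flat:=g_p(v,\cdot)$ for $v\in T_pM$, and let $g_\bullet(v^\flat,w^\flat):=g_p(v,w)$ be the induced inner product on $\flat(T_pM)\subseteq T_p^*M$. The Koszul form is $$\mathcal K(X,Y,Z)=\tfrac12\{X\langle Y,Z\rangle+Y\langle Z,X\rangle-Z\langle X,Y\rangle-\langle X,[Y,Z]\rangle+\langle Y,[Z,X]\rangle+\langle Z,[X,Y]\rangle\}.$$ The metric $g$ is \emph{semi-regular} if for all smooth local vector fields $X,Y,Z,T$ on an open set $U$: (i) $\mathcal K(X,Y,\cdot)_p\in\flat(T_pM)$ for every $p\in U$; and (ii) the contraction $\mathcal K(X,Y,{}_\bullet)\mathcal K(Z,T,{}_\bullet):=g_\bullet(\mathcal K(X,Y,\cdot),\mathcal K(Z,T,\cdot))$ is smooth, in the sense that its restriction to the (dense, open) set of points of $U$ near which the rank of $g$ is constant extends to a smooth function on $U$. At points where $g$ is non-degenerate put, in any chart, $\Gamma_{abc}=\mathcal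 K(\partial_a,\partial_b,\partial_c)$, $$R_{abcd}=\partial_a\Gamma_{bcd}-\partial_b\Gamma_{acd}+g^{st}(\Gamma_{acs}\Gamma_{bdt}-\Gamma_{bcs}\Gamma_{adt}),\quad R_{ab}=g^{st}R_{asbt},\quad R=g^{st}R_{st},\quad S_{ab}=R_{ab}-\tfrac1nRg_{ab},$$ $$S_{abcd}=\tfrac{1}{2n(n-1)}R\,(g\circ g)_{abcd},\qquad E_{abcd}=\tfrac1{n-2}(S\circ g)_{abcd},$$ where $(h\circ k)_{abcd}=h_{ac}k_{bd}-h_{ad}k_{bc}+h_{bd}k_{ac}-h_{bc}k_{ad}$. A semi-regular metric is \emph{quasi-regular} if it is non-degenerate on a dense subset of $M$ and the tensors $S_{abcd}$ and $E_{abcd}$, defined where $g$ is non-degenerate, extend to smooth tensor fields on all of $M$. A \emph{semi-regular spacetime} is a $4$-dimensional manifold with a semi-regular metric that at each point has at most three positive and at most one negative directions (counted by the signature) and is non-degenerate on a dense subset; it is a \emph{quasi-regular spacetime} if its metric is moreover quasi-regular. A \emph{regular spacetime} is a $4$-dimensional manifold with a smooth metric that is non-degenerate at every point and of signature $(-,+,+,+)$.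 \textbf{Theorem (Isotropic singularities).} Let $(M,g)$ be a regular spacetime and let $\Omega:M\to\mathbb R$ be a smooth function which is non-zero on a dense subset of $M$. Then $(M,\Omega^2g)$ is a quasi-regular spacetime: the metric $\Omega^2g$ is semi-regular and non-degenerate on a dense subset, has at most three positive and at most one negative directions at each point, and the scalar part $S_{abcd}$ and the semi-traceless part $E_{abcd}$ of its Riemann curvature extend smoothly to all of $M$, including the points where $\Omega=0$. -/

import Mathlib

open scoped Manifold ContDiff Topology Bundle

noncomputable section

namespace SingularSemiRiemannian

variable {n : ℕ} {M : Type*} [TopologicalSpace M] [ChartedSpace (EuclideanSpace ℝ (Fin n)) M]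

/-! ### Vector fields and metrics -/

/-- A smooth vector field on the set `U` (values outside `U` are irrelevant). -/
def SmoothVectorFieldOn [IsManifold (𝓡 n) ∞ M] (X : ∀ p : M, TangentSpace (𝓡 n) p) (U : Set M) :
    Prop :=
  ContMDiffOn (𝓡 n) (𝓡 n).tangent ∞ (fun p => (X p : TangentBundle (𝓡 n) M)) U

/-- A field of bilinear forms on the tangent spaces. -/
abbrev BilinField (n : ℕ) (M : Type*) [TopologicalSpace M]
    [ChartedSpace (EuclideanSpace ℝ (Fin n)) M] :=
  ∀ p : M, TangentSpace (𝓡 n) p →L[ℝ] TangentSpace (𝓡 n) p →L[ℝ] ℝ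

/-- A (possibly degenerate, of possibly variable signature) smooth metric: a smooth symmetric
tensor field of type `(0,2)`. -/
structure IsSingularMetric [IsManifold (𝓡 n) ∞ M] (g : BilinField n M) : Prop where
  symm : ∀ (p : M) (v w : TangentSpace (𝓡 n) p), g p v w = g p w v
  contMDiff : ContMDiff (𝓡 n)
    ((𝓡 n).prod 𝓘(ℝ, EuclideanSpace ℝ (Fin n) →L[ℝ] EuclideanSpace ℝ (Fin n) →L[ℝ] ℝ)) ∞
    (fun p => Bundle.TotalSpace.mk'
      (EuclideanSpace ℝ (Fin n) →L[ℝ] EuclideanSpace ℝ (Fin n) →L[ℝ] ℝ)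
      (E := fun p : M => TangentSpace (𝓡 n) p →L[ℝ] TangentSpace (𝓡 n) p →L[ℝ] ℝ) p (g p))

/-- The metric is non-degenerate at `p`. -/
def NondegenerateAt (g : BilinField n M) (p : M) : Prop :=
  ∀ v : TangentSpace (𝓡 n) p, (∀ w : TangentSpace (𝓡 n) p, g p v w = 0) → v = 0

/-- The rank of the metric at `p`, i.e. the dimension of `♭(T_pM)`. -/
def rankAt (g : BilinField n M) (p : M) : ℕ :=
  Module.finrank ℝ (LinearMap.range (g p).toLinearMap)

/-- The quadratic form `v ↦ g_p(v,v)` on `T_pM`. -/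
def quadForm (g : BilinField n M) (p : M) : QuadraticForm ℝ (TangentSpace (𝓡 n) p) :=
  LinearMap.BilinMap.toQuadraticMap
    ((ContinuousLinearMap.coeLM ℝ).comp (g p).toLinearMap :
      LinearMap.BilinForm ℝ (TangentSpace (𝓡 n) p))

/-! ### The Koszul form and semi-regular metrics -/

/-- The derivative `X f` of the function `f` along the vector field `X`, at `p`. -/
def dirDeriv (X : ∀ p : M, TangentSpace (𝓡 n) p) (f : M → ℝ) (p : M) : ℝ :=
  mfderiv (𝓡 n) 𝓘(ℝ, ℝ) f p (X p)

/-- The Koszul form `K(X,Y,Z)` of the metric `g`, at `p`. -/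
def koszul (g : BilinField n M) (X Y Z : ∀ p : M, TangentSpace (𝓡 n) p) (p : M) : ℝ :=
  (1 / 2) *
    (dirDeriv X (fun q => g q (Y q) (Z q)) p
      + dirDeriv Y (fun q => g q (Z q) (X q)) p
      - dirDeriv Z (fun q => g q (X q) (Y q)) p
      - g p (X p) (VectorField.mlieBracket (𝓡 n) Y Z p)
      + g p (Y p) (VectorField.mlieBracket (𝓡 n) Z X p)
      + g p (Z p) (VectorField.mlieBracket (𝓡 n) X Y p))

/-- The one-form `K(X,Y,_)` at `p` equals `v♭ = g_p(v,_)`. -/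
def KoszulEqFlat [IsManifold (𝓡 n) ∞ M] (g : BilinField n M)
    (X Y : ∀ p : M, TangentSpace (𝓡 n) p) (p : M) (v : TangentSpace (𝓡 n) p) : Prop :=
  ∀ (U : Set M) (Z : ∀ p : M, TangentSpace (𝓡 n) p), IsOpen U → p ∈ U →
    SmoothVectorFieldOn Z U → koszul g X Y Z p = g p v (Z p)

/-- Semi-regular metrics. The one-forms `K(X,Y,_)` lie in `♭(T_pM)` at every `p`, and the covariant
contraction `K(X,Y,•) K(Z,T,•)` is smooth. The covariant inner product on `♭(T_pM)` is
`g_•(v♭, w♭) = g_p(v, w)`. As this inner product may jump where the rank of the metric does,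
smoothness of the contraction means that the contraction, taken on the dense open set of points
around which the rank is constant, extends to a smooth function on the common domain of the
vector fields. -/
structure IsSemiRegular [IsManifold (𝓡 n) ∞ M] (g : BilinField n M) : Prop where
  isSingularMetric : IsSingularMetric g
  koszul_mem_flat : ∀ (U : Set M) (X Y : ∀ p : M, TangentSpace (𝓡 n) p), IsOpen U →
    SmoothVectorFieldOn X U → SmoothVectorFieldOn Y U →
      ∀ p ∈ U, ∃ v : TangentSpace (𝓡 n) p, KoszulEqFlat g X Y p v
  contraction_smooth : ∀ (U : Set M) (X Y Z T : ∀ p : M, TangentSpace (𝓡 n) p), IsOpen U →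
    SmoothVectorFieldOn X U → SmoothVectorFieldOn Y U →
    SmoothVectorFieldOn Z U → SmoothVectorFieldOn T U →
      ∃ F : M → ℝ, ContMDiffOn (𝓡 n) 𝓘(ℝ, ℝ) ∞ F U ∧
        ∀ p ∈ U, (∀ᶠ q in 𝓝 p, rankAt g q = rankAt g p) →
          ∀ v w : TangentSpace (𝓡 n) p,
            KoszulEqFlat g X Y p v → KoszulEqFlat g Z T p w → F p = g p v w

/-- The signature restriction of a spacetime metric: at each point at most three positive and at
most one negative directions. -/
def HasSpacetimeSignature (g : BilinField n M) : Prop :=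
  ∀ p : M, sigPos (quadForm g p) ≤ 3 ∧ sigNeg (quadForm g p) ≤ 1

/-! ### Curvature in the coordinates of a chart -/

/-- The constant vector field on `ℝⁿ` with value the `a`-th standard basis vector. -/
def stdField (a : Fin n) : ∀ x : EuclideanSpace ℝ (Fin n), TangentSpace (𝓡 n) x :=
  fun _ => EuclideanSpace.single a (1 : ℝ)

/-- The coordinate vector field `∂_a` of the chart `e` (meaningful on `e.source`). -/
def coordField (e : OpenPartialHomeomorph M (EuclideanSpace ℝ (Fin n))) (a : Fin n) :
    ∀ p : M, TangentSpace (𝓡 n) p :=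
  VectorField.mpullback (𝓡 n) (𝓡 n) e (stdField a)

/-- The components `g_{ab}` of the metric. -/
def metricMatrix (g : BilinField n M) (e : OpenPartialHomeomorph M (EuclideanSpace ℝ (Fin n)))
    (p : M) : Matrix (Fin n) (Fin n) ℝ :=
  Matrix.of fun a b => g p (coordField e a p) (coordField e b p)

/-- The components `g^{ab}` of the reciprocal metric, at a point where `g` is non-degenerate. -/
def invMetric (g : BilinField n M) (e : OpenPartialHomeomorph M (EuclideanSpace ℝ (Fin n)))
    (p : M) : Matrix (Fin n) (Fin n) ℝ :=
  (metricMatrix g e p)⁻¹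

/-- Christoffel's symbols of the first kind `Γ_{abc} = K(∂_a, ∂_b, ∂_c)`. -/
def christoffel (g : BilinField n M) (e : OpenPartialHomeomorph M (EuclideanSpace ℝ (Fin n)))
    (a b c : Fin n) (p : M) : ℝ :=
  koszul g (coordField e a) (coordField e b) (coordField e c) p

/-- The contraction `Γ_{ab•} Γ_{cd•} = g^{st} Γ_{abs} Γ_{cdt}`, at a point where `g` is
non-degenerate. -/
def christoffelContraction (g : BilinField n M)
    (e : OpenPartialHomeomorph M (EuclideanSpace ℝ (Fin n))) (a b c d : Fin n) (p : M) : ℝ :=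
  ∑ s, ∑ t, invMetric g e p s t * christoffel g e a b s p * christoffel g e c d t p

/-- The Riemann curvature
`R_{abcd} = ∂_a Γ_{bcd} - ∂_b Γ_{acd} + Γ_{ac•} Γ_{bd•} - Γ_{bc•} Γ_{ad•}`, at a point where `g` is
non-degenerate. -/
def riemann (g : BilinField n M) (e : OpenPartialHomeomorph M (EuclideanSpace ℝ (Fin n)))
    (p : M) (a b c d : Fin n) : ℝ :=
  dirDeriv (coordField e a) (christoffel g e b c d) p
    - dirDeriv (coordField e b) (christoffel g e a c d) p
    + christoffelContraction g e a c b d p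
    - christoffelContraction g e b c a d p

/-- The Ricci curvature `R_{ab} = g^{st} R_{asbt}`. -/
def ricci (g : BilinField n M) (e : OpenPartialHomeomorph M (EuclideanSpace ℝ (Fin n)))
    (p : M) (a b : Fin n) : ℝ :=
  ∑ s, ∑ t, invMetric g e p s t * riemann g e p a s b t

/-- The scalar curvature `R = g^{st} R_{st}`. -/
def scalarCurvature (g : BilinField n M)
    (e : OpenPartialHomeomorph M (EuclideanSpace ℝ (Fin n))) (p : M) : ℝ :=
  ∑ s, ∑ t, invMetric g e p s t * ricci g e p s t

/-- The traceless part `S_{ab} = R_{ab} - (1/n) R g_{ab}` of the Ricci curvature. -/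
def tracelessRicci (g : BilinField n M)
    (e : OpenPartialHomeomorph M (EuclideanSpace ℝ (Fin n))) (p : M) (a b : Fin n) : ℝ :=
  ricci g e p a b - 1 / (n : ℝ) * scalarCurvature g e p * metricMatrix g e p a b

/-- The Kulkarni–Nomizu product `h ∘ k`. -/
def kulkarniNomizu (h k : Fin n → Fin n → ℝ) (a b c d : Fin n) : ℝ :=
  h a c * k b d - h a d * k b c + h b d * k a c - h b c * k a d

/-- The scalar part `S_{abcd} = R (g ∘ g)_{abcd} / (2 n (n - 1))` of the Riemann curvature. -/
def scalarPart (g : BilinField n M) (e : OpenPartialHomeomorph M (EuclideanSpace ℝ (Fin n)))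
    (p : M) (a b c d : Fin n) : ℝ :=
  1 / (2 * (n : ℝ) * ((n : ℝ) - 1)) * scalarCurvature g e p *
    kulkarniNomizu (metricMatrix g e p) (metricMatrix g e p) a b c d

/-- The semi-traceless part `E_{abcd} = (S ∘ g)_{abcd} / (n - 2)` of the Riemann curvature. -/
def semiTracelessPart (g : BilinField n M)
    (e : OpenPartialHomeomorph M (EuclideanSpace ℝ (Fin n))) (p : M) (a b c d : Fin n) : ℝ :=
  1 / ((n : ℝ) - 2) * kulkarniNomizu (tracelessRicci g e p) (metricMatrix g e p) a b c d

/-! ### Quasi-regular metrics -/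

/-- A tensor field of type `(0,4)`. -/
abbrev TensorField4 (n : ℕ) (M : Type*) [TopologicalSpace M]
    [ChartedSpace (EuclideanSpace ℝ (Fin n)) M] :=
  ∀ p : M, TangentSpace (𝓡 n) p →ₗ[ℝ] TangentSpace (𝓡 n) p →ₗ[ℝ]
    TangentSpace (𝓡 n) p →ₗ[ℝ] TangentSpace (𝓡 n) p →ₗ[ℝ] ℝ

/-- A tensor field of type `(0,4)` is smooth if its values on smooth local vector fields are. -/
def TensorField4.Smooth [IsManifold (𝓡 n) ∞ M] (A : TensorField4 n M) : Prop :=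
  ∀ (U : Set M) (X Y Z T : ∀ p : M, TangentSpace (𝓡 n) p), IsOpen U →
    SmoothVectorFieldOn X U → SmoothVectorFieldOn Y U →
    SmoothVectorFieldOn Z U → SmoothVectorFieldOn T U →
      ContMDiffOn (𝓡 n) 𝓘(ℝ, ℝ) ∞ (fun p => A p (X p) (Y p) (Z p) (T p)) U

/-- The tensor whose components in a chart `e` are `comp e p a b c d` at the points `p` where `g` is
non-degenerate extends to a smooth tensor field on the entire manifold. -/
def ExtendsSmoothly [IsManifold (𝓡 n) ∞ M] (g : BilinField n M)
    (comp : OpenPartialHomeomorph M (EuclideanSpace ℝ (Fin n)) → M →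
      Fin n → Fin n → Fin n → Fin n → ℝ) : Prop :=
  ∃ A : TensorField4 n M, A.Smooth ∧
    ∀ e ∈ IsManifold.maximalAtlas (𝓡 n) ∞ M, ∀ p ∈ e.source, NondegenerateAt g p →
      ∀ a b c d : Fin n,
        A p (coordField e a p) (coordField e b p) (coordField e c p) (coordField e d p)
          = comp e p a b c d

/-- Quasi-regular metrics. -/
structure IsQuasiRegular [IsManifold (𝓡 n) ∞ M] (g : BilinField n M) : Prop where
  isSemiRegular : IsSemiRegular g
  dense_nondegenerate : Dense {p : M | NondegenerateAt g p}
  scalarPart_extends : ExtendsSmoothly g (scalarPart g)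
  semiTracelessPart_extends : ExtendsSmoothly g (semiTracelessPart g)

/-! ### Spacetimes -/

/-- Semi-regular spacetimes: four-dimensional semi-regular manifolds whose metric has spacetime
signature and is non-degenerate on a dense subset. -/
structure IsSemiRegularSpacetime {M : Type*} [TopologicalSpace M]
    [ChartedSpace (EuclideanSpace ℝ (Fin 4)) M] [IsManifold (𝓡 4) ∞ M] (g : BilinField 4 M) :
    Prop where
  isSemiRegular : IsSemiRegular g
  signature : HasSpacetimeSignature g
  dense_nondegenerate : Dense {p : M | NondegenerateAt g p}

/-- Quasi-regular spacetimes. -/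
structure IsQuasiRegularSpacetime {M : Type*} [TopologicalSpace M]
    [ChartedSpace (EuclideanSpace ℝ (Fin 4)) M] [IsManifold (𝓡 4) ∞ M] (g : BilinField 4 M) :
    Prop where
  isSemiRegularSpacetime : IsSemiRegularSpacetime g
  isQuasiRegular : IsQuasiRegular g

/-- Regular spacetimes: four-dimensional manifolds with a smooth metric that is non-degenerate at
every point and of spacetime signature, hence of Lorentzian signature `(-,+,+,+)`. -/
structure IsRegularSpacetime {M : Type*} [TopologicalSpace M]
    [ChartedSpace (EuclideanSpace ℝ (Fin 4)) M] [IsManifold (𝓡 4) ∞ M] (g : BilinField 4 M) :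
    Prop where
  isSingularMetric : IsSingularMetric g
  nondegenerate : ∀ p : M, NondegenerateAt g p
  signature : HasSpacetimeSignature g

/-- The conformally rescaled metric `Ω² g`. -/
def conformalRescaling (Ω : M → ℝ) (g : BilinField n M) : BilinField n M :=
  fun p => (Ω p ^ 2) • g p

end SingularSemiRiemannian

end

/-!
Write `g̃ = Ω² g`. The Koszul form of `g̃` is `Ω θ`, where `θ(X,Y,Z) = Ω K(X,Y,Z) + XΩ ⟨Y,Z⟩ + YΩ
⟨X,Z⟩ - ZΩ ⟨X,Y⟩` is smooth (`koszul_conformalRescaling`). The reciprocal metric of `g̃` is `Ω⁻²`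
times that of `g`, so the contraction of two Koszul forms of `g̃` is the contraction of the
corresponding `θ` with respect to the non-degenerate metric `g`, hence smooth. This is
semi-regularity (`isSemiRegular_conformalRescaling`); the zeros of `Ω` do not interfere with the
condition on the contraction, as the rank of `g̃` is not constant near any of them.

For the same reason the components `R̃_{abcd}` of the Riemann curvature of `g̃` in a chart extend
smoothly across the zeros of `Ω` (`rescaledCurvature`), and with them `Ω² R̃_{ab} = g^{st}
R̃_{asbt}` and `Ω⁴ R̃ = g^{ab} g^{st} R̃_{asbt}`. The factors `g̃ = Ω² g` in the Kulkarni–Nomizu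
products `R̃ (g̃ ∘ g̃)` and `S̃ ∘ g̃` supply exactly these powers of `Ω`, so that the scalar part
and the semi-traceless part extend as well. No explicit formula for the curvature of `g̃` is
needed.

The extensions are defined in charts and have to be shown independent of the chart. Where `Ω ≠ 0`
this is the tensoriality of the curvature of `g̃`, which is proved by computing how Christoffel's
symbols and their derivatives transform under a diffeomorphism (`curvatureForm_pullback`). By
density and continuity it follows at the zeros of `Ω` (`rescaledRicciBilin_transition`).
-/

open scoped Manifold ContDiff Topology Bundle

-- needed to find the normed structures on iterated spaces of continuous linear maps
set_option maxSynthPendingDepth 3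

noncomputable section

namespace SingularSemiRiemannian

/-! ### Traces with respect to a non-degenerate inner product -/

section

variable {n : ℕ}

/-- The Gram matrix of a bilinear form on `ℝⁿ` in the standard basis. -/
def gram (B : EuclideanSpace ℝ (Fin n) →L[ℝ] EuclideanSpace ℝ (Fin n) →L[ℝ] ℝ) :
    Matrix (Fin n) (Fin n) ℝ :=
  Matrix.of fun a b => B (EuclideanSpace.single a 1) (EuclideanSpace.single b 1)

/-- The trace `g^{st} f_{st}` of `f` with respect to the inner product `B`, which is meaningful if
`B`
is non-degenerate and `f` is bilinear. -/
def metricTrace (B : EuclideanSpace ℝ (Fin n) →L[ℝ] EuclideanSpace ℝ (Fin n) →L[ℝ] ℝ)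
    (f : EuclideanSpace ℝ (Fin n) → EuclideanSpace ℝ (Fin n) → ℝ) : ℝ :=
  ∑ s, ∑ t, (gram B)⁻¹ s t * f (EuclideanSpace.single s 1) (EuclideanSpace.single t 1)

lemma sum_smul_single (v : EuclideanSpace ℝ (Fin n)) :
    ∑ a, v a • EuclideanSpace.single a (1 : ℝ) = v := by
  have := (EuclideanSpace.basisFun (Fin n) ℝ).sum_repr v
  simpa using this

lemma bilin_eq_sum (F : EuclideanSpace ℝ (Fin n) →ₗ[ℝ] EuclideanSpace ℝ (Fin n) →ₗ[ℝ] ℝ)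
    (u v : EuclideanSpace ℝ (Fin n)) :
    F u v = ∑ a, ∑ b, u a * v b *
      F (EuclideanSpace.single a 1) (EuclideanSpace.single b 1) := by
  conv_lhs => rw [← sum_smul_single u, ← sum_smul_single v]
  simp only [map_sum, map_smul, LinearMap.sum_apply, LinearMap.smul_apply, smul_eq_mul,
    Finset.mul_sum]
  rw [Finset.sum_comm]
  exact Finset.sum_congr rfl fun _ _ => Finset.sum_congr rfl fun _ _ => by ring

lemma metricTrace_eq_trace (B : EuclideanSpace ℝ (Fin n) →L[ℝ] EuclideanSpace ℝ (Fin n) →L[ℝ] ℝ)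
    (f : EuclideanSpace ℝ (Fin n) → EuclideanSpace ℝ (Fin n) → ℝ) :
    metricTrace B f = ((gram B)⁻¹ * (Matrix.of fun a b =>
      f (EuclideanSpace.single a 1) (EuclideanSpace.single b 1)).transpose).trace := by
  simp [metricTrace, Matrix.trace, Matrix.mul_apply]

/-- The trace is natural under linear isomorphisms; in particular it does not depend on the basis
used to define it. -/
lemma metricTrace_pullback {B B' : EuclideanSpace ℝ (Fin n) →L[ℝ] EuclideanSpace ℝ (Fin n) →L[ℝ] ℝ}
    {f : EuclideanSpace ℝ (Fin n) → EuclideanSpace ℝ (Fin n) → ℝ}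
    (F : EuclideanSpace ℝ (Fin n) →ₗ[ℝ] EuclideanSpace ℝ (Fin n) →ₗ[ℝ] ℝ)
    (J : EuclideanSpace ℝ (Fin n) ≃L[ℝ] EuclideanSpace ℝ (Fin n))
    (hB : ∀ u v, B u v = B' (J u) (J v)) (hf : ∀ u v, f u v = F (J u) (J v)) :
    metricTrace B f = metricTrace B' fun u v => F u v := by
  -- the matrices of `J` and of its inverse; Gram matrices transform by the congruence `Pᵀ _ P`
  let P : Matrix (Fin n) (Fin n) ℝ := Matrix.of fun a b => J (EuclideanSpace.single b 1) a
  let Q : Matrix (Fin n) (Fin n) ℝ := Matrix.of fun a b => J.symm (EuclideanSpace.single b 1) a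
  have hPQ : P * Q = 1 := by
    ext a b
    have h := congrArg (fun v : EuclideanSpace ℝ (Fin n) => v a)
      (congrArg J (sum_smul_single (J.symm (EuclideanSpace.single b 1))))
    simp only [map_sum, map_smul, ContinuousLinearEquiv.apply_symm_apply] at h
    simp only [P, Q, Matrix.mul_apply, Matrix.of_apply, Matrix.one_apply]
    simpa [mul_comm, Pi.single_apply] using h
  have key : ∀ F : EuclideanSpace ℝ (Fin n) →ₗ[ℝ] EuclideanSpace ℝ (Fin n) →ₗ[ℝ] ℝ,
      (Matrix.of fun a b => F (J (EuclideanSpace.single a 1)) (J (EuclideanSpace.single b 1))) =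
        P.transpose * (Matrix.of fun a b =>
          F (EuclideanSpace.single a 1) (EuclideanSpace.single b 1)) * P := by
    intro F
    ext a b
    rw [Matrix.of_apply, bilin_eq_sum, Finset.sum_comm]
    simp only [P, Matrix.mul_apply, Matrix.transpose_apply, Matrix.of_apply, Finset.sum_mul]
    exact Finset.sum_congr rfl fun _ _ => Finset.sum_congr rfl fun _ _ => by ring
  have hBm : gram B = P.transpose * gram B' * P := by
    have := key ((ContinuousLinearMap.coeLM ℝ).comp B'.toLinearMap)
    simp only [gram, hB]
    exact this
  have hfm : (Matrix.of fun a b => f (EuclideanSpace.single a 1) (EuclideanSpace.single b 1)) =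
      P.transpose * (Matrix.of fun a b =>
          F (EuclideanSpace.single a 1) (EuclideanSpace.single b 1)) * P := by
    simpa only [hf] using key F
  have hQP : Q * P = 1 := mul_eq_one_comm.1 hPQ
  have hPi : P⁻¹ = Q := Matrix.inv_eq_right_inv hPQ
  have hPti : (P.transpose)⁻¹ = Q.transpose := by rw [← Matrix.transpose_nonsing_inv, hPi]
  have hQPt : Q.transpose * P.transpose = 1 := by rw [← Matrix.transpose_mul, hPQ,
      Matrix.transpose_one]
  rw [metricTrace_eq_trace, metricTrace_eq_trace, hBm, hfm, Matrix.mul_inv_rev, Matrix.mul_inv_rev,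
    hPi, hPti, Matrix.transpose_mul, Matrix.transpose_mul, Matrix.transpose_transpose]
  set S := (Matrix.of fun a b => F (EuclideanSpace.single a 1)
    (EuclideanSpace.single b 1)).transpose
  calc (Q * ((gram B')⁻¹ * Q.transpose) * (P.transpose * (S * P))).trace
      = (Q * ((gram B')⁻¹ * (Q.transpose * P.transpose) * S * P)).trace := by
        simp only [Matrix.mul_assoc]
    _ = ((gram B')⁻¹ * S * (P * Q)).trace := by
        rw [hQPt, Matrix.trace_mul_comm]; simp only [Matrix.mul_assoc, Matrix.mul_one]
    _ = _ := by rw [hPQ, Matrix.mul_one]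

lemma isUnit_det_gram {B : EuclideanSpace ℝ (Fin n) →L[ℝ] EuclideanSpace ℝ (Fin n) →L[ℝ] ℝ}
    (hB : ∀ v, (∀ w, B v w = 0) → v = 0) : IsUnit (gram B).det := by
  rw [isUnit_iff_ne_zero]
  intro h0
  obtain ⟨v, hv, hv0⟩ := Matrix.exists_vecMul_eq_zero_iff.2 h0
  refine hv ?_
  have : WithLp.toLp 2 v = (0 : EuclideanSpace ℝ (Fin n)) := by
    refine hB _ fun w => ?_
    have := bilin_eq_sum ((ContinuousLinearMap.coeLM ℝ).comp B.toLinearMap) (WithLp.toLp 2 v) w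
    change B _ _ = _ at this
    rw [this, Finset.sum_comm]
    refine Finset.sum_eq_zero fun b _ => ?_
    have hb := congrFun hv0 b
    simp only [Matrix.vecMul, dotProduct, gram, Matrix.of_apply, Pi.zero_apply] at hb
    rw [← mul_zero (w b), ← hb, Finset.mul_sum]
    exact Finset.sum_congr rfl fun a _ => by
      simp only [LinearMap.comp_apply]
      change v a * w b * B _ _ = _
      ring
  exact congrArg WithLp.ofLp this

/-- If `α = v♭`, then `g_•(α, β) = β(v)`. -/
lemma metricTrace_flat_left {B : EuclideanSpace ℝ (Fin n) →L[ℝ] EuclideanSpace ℝ (Fin n) →L[ℝ] ℝ}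
    (hB : ∀ v, (∀ w, B v w = 0) → v = 0)
    (v : EuclideanSpace ℝ (Fin n)) (β : EuclideanSpace ℝ (Fin n) →ₗ[ℝ] ℝ) :
    metricTrace B (fun s t => B v s * β t) = β v := by
  have h1 : ∀ t, ∑ s, (gram B)⁻¹ s t * B v (EuclideanSpace.single s 1) = v t := by
    intro t
    have h2 : ∀ s, B v (EuclideanSpace.single s 1) = ∑ r, v r * gram B r s := by
      intro s
      conv_lhs => rw [← sum_smul_single v]
      simp [gram]
    have h3 : ∀ r, ∑ s, gram B r s * (gram B)⁻¹ s t = (1 : Matrix (Fin n) (Fin n) ℝ) r t := by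
      intro r
      rw [← Matrix.mul_nonsing_inv _ (isUnit_det_gram hB), Matrix.mul_apply]
    calc _ = ∑ s, ∑ r, v r * (gram B r s * (gram B)⁻¹ s t) := by
          refine Finset.sum_congr rfl fun s _ => ?_
          rw [h2, Finset.mul_sum]
          exact Finset.sum_congr rfl fun r _ => by ring
      _ = ∑ r, v r * ∑ s, gram B r s * (gram B)⁻¹ s t := by
          rw [Finset.sum_comm]; simp only [Finset.mul_sum]
      _ = v t := by simp [h3, Matrix.one_apply]
  rw [metricTrace, Finset.sum_comm]
  conv_rhs => rw [← sum_smul_single v]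
  rw [map_sum]
  refine Finset.sum_congr rfl fun t _ => ?_
  rw [map_smul, smul_eq_mul, ← h1 t, Finset.sum_mul]
  exact Finset.sum_congr rfl fun s _ => by ring

lemma gram_transpose {B : EuclideanSpace ℝ (Fin n) →L[ℝ] EuclideanSpace ℝ (Fin n) →L[ℝ] ℝ}
    (hs : ∀ v w, B v w = B w v) : (gram B).transpose = gram B := by
  ext a b; exact hs _ _

lemma metricTrace_swap {B : EuclideanSpace ℝ (Fin n) →L[ℝ] EuclideanSpace ℝ (Fin n) →L[ℝ] ℝ}
    (hs : ∀ v w, B v w = B w v) (f : EuclideanSpace ℝ (Fin n) → EuclideanSpace ℝ (Fin n) → ℝ) :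
    metricTrace B (fun s t => f t s) = metricTrace B f := by
  have : ∀ s t, (gram B)⁻¹ s t = (gram B)⁻¹ t s := fun s t => by
    conv_lhs => rw [← gram_transpose hs, ← Matrix.transpose_nonsing_inv, Matrix.transpose_apply]
  rw [metricTrace, Finset.sum_comm, metricTrace]
  exact Finset.sum_congr rfl fun s _ => Finset.sum_congr rfl fun t _ => by rw [this]

lemma metricTrace_flat_right {B : EuclideanSpace ℝ (Fin n) →L[ℝ] EuclideanSpace ℝ (Fin n) →L[ℝ] ℝ}
    (hB : ∀ v, (∀ w, B v w = 0) → v = 0) (hs : ∀ v w, B v w = B w v)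
    (v : EuclideanSpace ℝ (Fin n)) (β : EuclideanSpace ℝ (Fin n) →ₗ[ℝ] ℝ) :
    metricTrace B (fun s t => β s * B v t) = β v := by
  rw [← metricTrace_flat_left hB v β, ← metricTrace_swap hs]
  simp only [mul_comm]

lemma metricTrace_add (B : EuclideanSpace ℝ (Fin n) →L[ℝ] EuclideanSpace ℝ (Fin n) →L[ℝ] ℝ)
    (f h : EuclideanSpace ℝ (Fin n) → EuclideanSpace ℝ (Fin n) → ℝ) :
    metricTrace B (fun s t => f s t + h s t) = metricTrace B f + metricTrace B h := by
  simp only [metricTrace, mul_add, Finset.sum_add_distrib]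

lemma metricTrace_const_mul (B : EuclideanSpace ℝ (Fin n) →L[ℝ] EuclideanSpace ℝ (Fin n) →L[ℝ] ℝ)
    (c : ℝ) (f : EuclideanSpace ℝ (Fin n) → EuclideanSpace ℝ (Fin n) → ℝ) :
    metricTrace B (fun s t => c * f s t) = c * metricTrace B f := by
  simp only [metricTrace, Finset.mul_sum]
  exact Finset.sum_congr rfl fun s _ => Finset.sum_congr rfl fun t _ => by ring

lemma metricTrace_smul_metric (B : EuclideanSpace ℝ (Fin n) →L[ℝ] EuclideanSpace ℝ (Fin n) →L[ℝ] ℝ)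
    {c : ℝ} (hc : c ≠ 0) (f : EuclideanSpace ℝ (Fin n) → EuclideanSpace ℝ (Fin n) → ℝ) :
    metricTrace (c • B) f = c⁻¹ * metricTrace B f := by
  have h : gram (c • B) = (Units.mk0 c hc) • gram B := by ext a b; simp [gram, Units.smul_def]
  have h' : (gram (c • B))⁻¹ = c⁻¹ • (gram B)⁻¹ := by
    by_cases hd : IsUnit (gram B).det
    · rw [h, Units.smul_def, Matrix.inv_smul (gram B) _ hd]; rfl
    · have hd' : ¬ IsUnit (gram (c • B)).det := by
        rw [h, Units.smul_def, Matrix.det_smul]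
        simpa [isUnit_iff_ne_zero, hc] using hd
      rw [Matrix.nonsing_inv_apply_not_isUnit _ hd, Matrix.nonsing_inv_apply_not_isUnit _ hd',
        smul_zero]
  simp only [metricTrace, h', Finset.mul_sum]
  exact Finset.sum_congr rfl fun s _ => Finset.sum_congr rfl fun t _ => by simp [mul_assoc]

end

/-! ### Christoffel's symbols and curvature on open sets of a vector space -/

section

variable {n : ℕ} {V : Type*} [NormedAddCommGroup V] [NormedSpace ℝ V]

/-- Christoffel's symbols of the first kind of a metric on an open subset of a normed space, as a
trilinear form. -/
def christoffelForm
    (G : V → V →L[ℝ] V →L[ℝ] ℝ)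
    (x u v w : V) : ℝ :=
  (1 / 2) * (fderiv ℝ G x u v w + fderiv ℝ G x v w u - fderiv ℝ G x w u v)

section Derivatives

variable {G : V → V →L[ℝ] V →L[ℝ] ℝ}
  {x : V}

lemma fderiv_christoffelForm (hG : ContDiffAt ℝ 2 G x) (a u v w : V) :
    fderiv ℝ (fun y => christoffelForm G y u v w) x a =
      (1 / 2) * (fderiv ℝ (fderiv ℝ G) x a u v w + fderiv ℝ (fderiv ℝ G) x a v w u
        - fderiv ℝ (fderiv ℝ G) x a w u v) := by
  have hd : HasFDerivAt (fderiv ℝ G) (fderiv ℝ (fderiv ℝ G) x) x :=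
    ((hG.fderiv_right (m := 1) (by norm_num)).differentiableAt (by norm_num)).hasFDerivAt
  have h3 : ∀ u v w : V, HasFDerivAt (fun y => fderiv ℝ G y u v w)
      (((fderiv ℝ (fderiv ℝ G) x).flip u).flip v |>.flip w) x := fun u v w => by
    have := ((hd.clm_apply (hasFDerivAt_const u x)).clm_apply (hasFDerivAt_const v x)).clm_apply
      (hasFDerivAt_const w x)
    refine this.congr_fderiv ?_
    ext; simp
  have := (((h3 u v w).add (h3 v w u)).sub (h3 w u v)).const_mul (1 / 2 : ℝ)
  have := this.fderiv
  simp only [christoffelForm]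
  erw [this]
  simp

/-- The derivative of a metric is symmetric in the arguments of the metric. -/
lemma fderiv_metric_symm
    (hs : ∀ᶠ y in 𝓝 x, ∀ u v, G y u v = G y v u) (hG : DifferentiableAt ℝ G x)
    (a u v : V) : fderiv ℝ G x a u v = fderiv ℝ G x a v u := by
  have h2 : ∀ u v : V, HasFDerivAt (fun y => G y u v)
      (((fderiv ℝ G x).flip u).flip v) x := fun u v => by
    have := (hG.hasFDerivAt.clm_apply (hasFDerivAt_const u x)).clm_apply (hasFDerivAt_const v x)
    refine this.congr_fderiv ?_
    ext; simp
  have h : (fun y => G y u v) =ᶠ[𝓝 x] fun y => G y v u := hs.mono fun y hy => hy u v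
  have := h.fderiv_eq (𝕜 := ℝ)
  rw [(h2 u v).fderiv, (h2 v u).fderiv] at this
  exact congrArg (fun l => l a) this

end Derivatives

section Pullback

variable {G G' : V → V →L[ℝ] V →L[ℝ] ℝ}
  {φ : V → V} {x : V}

lemma fderiv_pullback (hG : DifferentiableAt ℝ G x) (hG' : DifferentiableAt ℝ G' (φ x))
    (hφ : ContDiffAt ℝ 2 φ x)
    (h : ∀ᶠ y in 𝓝 x, ∀ u v, G y u v = G' (φ y) (fderiv ℝ φ y u) (fderiv ℝ φ y v))
    (a u v : V) :
    fderiv ℝ G x a u v =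
      fderiv ℝ G' (φ x) (fderiv ℝ φ x a) (fderiv ℝ φ x u) (fderiv ℝ φ x v)
      + G' (φ x) (fderiv ℝ (fderiv ℝ φ) x a u) (fderiv ℝ φ x v)
      + G' (φ x) (fderiv ℝ φ x u) (fderiv ℝ (fderiv ℝ φ) x a v) := by
  have h1 := (hG.hasFDerivAt.clm_apply (hasFDerivAt_const u x)).clm_apply (hasFDerivAt_const v x)
  have hJ : HasFDerivAt (fderiv ℝ φ) (fderiv ℝ (fderiv ℝ φ) x) x :=
    ((hφ.fderiv_right (m := 1) (by norm_num)).differentiableAt (by norm_num)).hasFDerivAt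
  have hφ1 : HasFDerivAt φ (fderiv ℝ φ x) x := (hφ.differentiableAt (by norm_num)).hasFDerivAt
  have h2 := ((hG'.hasFDerivAt.comp x hφ1).clm_apply
    (hJ.clm_apply (hasFDerivAt_const u x))).clm_apply (hJ.clm_apply (hasFDerivAt_const v x))
  have h3 : (fun y => G y u v) =ᶠ[𝓝 x]
      fun y => G' (φ y) (fderiv ℝ φ y u) (fderiv ℝ φ y v) := h.mono fun y hy => hy u v
  have h4 := congrArg (fun l => l a) (h1.unique (h2.congr_of_eventuallyEq h3))
  simp at h4
  rw [h4]
  ring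

/-- The transformation law of Christoffel's symbols, which involves the second derivative of the
coordinate change `φ`. -/
lemma christoffelForm_pullback (hG : DifferentiableAt ℝ G x) (hG' : DifferentiableAt ℝ G' (φ x))
    (hφ : ContDiffAt ℝ 2 φ x) (hs : ∀ u v, G' (φ x) u v = G' (φ x) v u)
    (h : ∀ᶠ y in 𝓝 x, ∀ u v, G y u v = G' (φ y) (fderiv ℝ φ y u) (fderiv ℝ φ y v))
    (u v w : V) :
    christoffelForm G x u v w =
      christoffelForm G' (φ x) (fderiv ℝ φ x u) (fderiv ℝ φ x v) (fderiv ℝ φ x w)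
      + G' (φ x) (fderiv ℝ (fderiv ℝ φ) x u v) (fderiv ℝ φ x w) := by
  have hsym : ∀ u v, fderiv ℝ (fderiv ℝ φ) x u v = fderiv ℝ (fderiv ℝ φ) x v u :=
    fun u v => (hφ.isSymmSndFDerivAt (by simp)).eq u v
  simp only [christoffelForm, fderiv_pullback hG hG' hφ h]
  rw [hsym v u, hsym w u, hsym w v, hs _ (fderiv ℝ (fderiv ℝ φ) x u w),
    hs (fderiv ℝ φ x w), hs _ (fderiv ℝ (fderiv ℝ φ) x v w)]
  ring

/-- The derivative of the transformation law of Christoffel's symbols. -/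
lemma fderiv_christoffelForm_pullback (hG : ContDiffAt ℝ 2 G x) (hG' : ContDiffAt ℝ 2 G' (φ x))
    (hφ : ContDiffAt ℝ 3 φ x) (hs : ∀ᶠ y in 𝓝 (φ x), ∀ u v, G' y u v = G' y v u)
    (h : ∀ᶠ y in 𝓝 x, ∀ u v, G y u v = G' (φ y) (fderiv ℝ φ y u) (fderiv ℝ φ y v))
    (a u v w : V) :
    fderiv ℝ (fun y => christoffelForm G y u v w) x a =
      fderiv ℝ (fun y => christoffelForm G' y (fderiv ℝ φ x u) (fderiv ℝ φ x v) (fderiv ℝ φ x w))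
        (φ x) (fderiv ℝ φ x a)
      + christoffelForm G' (φ x) (fderiv ℝ (fderiv ℝ φ) x a u) (fderiv ℝ φ x v) (fderiv ℝ φ x w)
      + christoffelForm G' (φ x) (fderiv ℝ φ x u) (fderiv ℝ (fderiv ℝ φ) x a v) (fderiv ℝ φ x w)
      + christoffelForm G' (φ x) (fderiv ℝ φ x u) (fderiv ℝ φ x v) (fderiv ℝ (fderiv ℝ φ) x a w)
      + fderiv ℝ G' (φ x) (fderiv ℝ φ x a) (fderiv ℝ (fderiv ℝ φ) x u v) (fderiv ℝ φ x w)
      + G' (φ x) (fderiv ℝ (fderiv ℝ (fderiv ℝ φ)) x a u v) (fderiv ℝ φ x w)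
      + G' (φ x) (fderiv ℝ (fderiv ℝ φ) x u v) (fderiv ℝ (fderiv ℝ φ) x a w) := by
  have hφ' : ContDiffAt ℝ 2 (fderiv ℝ φ) x := hφ.fderiv_right (by norm_num)
  have hφc : ContinuousAt φ x := hφ.continuousAt
  have hev : (fun y => christoffelForm G y u v w) =ᶠ[𝓝 x] fun y =>
      (1 / 2) * (fderiv ℝ G' (φ y) (fderiv ℝ φ y u) (fderiv ℝ φ y v) (fderiv ℝ φ y w)
        + fderiv ℝ G' (φ y) (fderiv ℝ φ y v) (fderiv ℝ φ y w) (fderiv ℝ φ y u)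
        - fderiv ℝ G' (φ y) (fderiv ℝ φ y w) (fderiv ℝ φ y u) (fderiv ℝ φ y v))
      + G' (φ y) (fderiv ℝ (fderiv ℝ φ) y u v) (fderiv ℝ φ y w) := by
    filter_upwards [h.eventually_nhds, hG.eventually (by simp),
      hφc.eventually (hG'.eventually (by simp)), hφ.eventually (by simp),
      hφc.eventually hs] with y h1 h2 h3 h4 h5
    rw [christoffelForm_pullback (h2.differentiableAt (by norm_num))
      (h3.differentiableAt (by norm_num)) (h4.of_le (by norm_num)) h5 h1]
    rfl
  have hG1 : HasFDerivAt G' (fderiv ℝ G' (φ x)) (φ x) :=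
    (hG'.differentiableAt (by norm_num)).hasFDerivAt
  have hG2 : HasFDerivAt (fderiv ℝ G') (fderiv ℝ (fderiv ℝ G') (φ x)) (φ x) :=
    ((hG'.fderiv_right (m := 1) (by norm_num)).differentiableAt (by norm_num)).hasFDerivAt
  have hJ : HasFDerivAt (fderiv ℝ φ) (fderiv ℝ (fderiv ℝ φ) x) x :=
    (hφ'.differentiableAt (by norm_num)).hasFDerivAt
  have hH : HasFDerivAt (fderiv ℝ (fderiv ℝ φ)) (fderiv ℝ (fderiv ℝ (fderiv ℝ φ)) x) x :=
    ((hφ'.fderiv_right (m := 1) (by norm_num)).differentiableAt (by norm_num)).hasFDerivAt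
  have hφ1 : HasFDerivAt φ (fderiv ℝ φ x) x := (hφ.differentiableAt (by norm_num)).hasFDerivAt
  have hJu := fun u => hJ.clm_apply (hasFDerivAt_const u x)
  have h3 := fun u v w => (((hG2.comp x hφ1).clm_apply (hJu u)).clm_apply (hJu v)).clm_apply (hJu w)
  have h4 := ((hG1.comp x hφ1).clm_apply ((hH.clm_apply (hasFDerivAt_const u x)).clm_apply
    (hasFDerivAt_const v x))).clm_apply (hJu w)
  have h5 := (((((h3 u v w).add (h3 v w u)).sub (h3 w u v)).const_mul (1 / 2 : ℝ)).add
    h4).congr_of_eventuallyEq hev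
  rw [h5.fderiv, fderiv_christoffelForm hG']
  simp [christoffelForm]
  ring

end Pullback

/-- The Riemann curvature of a metric on an open subset of `ℝⁿ`. -/
def curvatureForm
    (G : EuclideanSpace ℝ (Fin n) → EuclideanSpace ℝ (Fin n) →L[ℝ] EuclideanSpace ℝ (Fin n) →L[ℝ] ℝ)
    (x u v w z : EuclideanSpace ℝ (Fin n)) : ℝ :=
  fderiv ℝ (fun y => christoffelForm G y v w z) x u
    - fderiv ℝ (fun y => christoffelForm G y u w z) x v
    + metricTrace (G x) (fun s t => christoffelForm G x u w s * christoffelForm G x v z t)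
    - metricTrace (G x) (fun s t => christoffelForm G x v w s * christoffelForm G x u z t)

/-- The Ricci curvature of a metric on an open subset of `ℝⁿ`. -/
def ricciForm
    (G : EuclideanSpace ℝ (Fin n) → EuclideanSpace ℝ (Fin n) →L[ℝ] EuclideanSpace ℝ (Fin n) →L[ℝ] ℝ)
    (x u v : EuclideanSpace ℝ (Fin n)) : ℝ :=
  metricTrace (G x) fun s t => curvatureForm G x u s v t

end

/-! ### Naturality of the curvature -/

section

variable {n : ℕ} {V : Type*} [NormedAddCommGroup V] [NormedSpace ℝ V]

/-- Christoffel's symbols of the first kind, as a linear form in the last argument. -/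
def christoffelLin (G : V → V →L[ℝ] V →L[ℝ] ℝ) (x u v : V) : V →ₗ[ℝ] ℝ where
  toFun := christoffelForm G x u v
  map_add' a b := by simp [christoffelForm]; ring
  map_smul' a b := by simp [christoffelForm]; ring

@[simp] lemma christoffelLin_apply (G : V → V →L[ℝ] V →L[ℝ] ℝ) (x u v w : V) :
    christoffelLin G x u v w = christoffelForm G x u v w := rfl

section Linearity

variable (G : V → V →L[ℝ] V →L[ℝ] ℝ) (x : V)

lemma christoffelForm_linear_left (a : ℝ) (u u' v w : V) :
    christoffelForm G x (a • u + u') v w =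
      a * christoffelForm G x u v w + christoffelForm G x u' v w := by
  simp [christoffelForm]; ring

lemma christoffelForm_linear_middle (a : ℝ) (u v v' w : V) :
    christoffelForm G x u (a • v + v') w =
      a * christoffelForm G x u v w + christoffelForm G x u v' w := by
  simp [christoffelForm]; ring

end Linearity

section Contraction

variable (B : EuclideanSpace ℝ (Fin n) →L[ℝ] EuclideanSpace ℝ (Fin n) →L[ℝ] ℝ)

lemma metricTrace_linear_left (a : ℝ) (α α' β : EuclideanSpace ℝ (Fin n) → ℝ) :
    metricTrace B (fun s t => (a * α s + α' s) * β t) =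
      a * metricTrace B (fun s t => α s * β t) + metricTrace B (fun s t => α' s * β t) := by
  rw [← metricTrace_const_mul, ← metricTrace_add]
  congr 1; ext s t; ring

lemma metricTrace_linear_right (a : ℝ) (α β β' : EuclideanSpace ℝ (Fin n) → ℝ) :
    metricTrace B (fun s t => α s * (a * β t + β' t)) =
      a * metricTrace B (fun s t => α s * β t) + metricTrace B (fun s t => α s * β' t) := by
  rw [← metricTrace_const_mul, ← metricTrace_add]
  congr 1; ext s t; ring

variable {B}

/-- The contraction `g_•(α + h♭, β + k♭)`. -/
lemma metricTrace_add_flat (hB : ∀ v, (∀ w, B v w = 0) → v = 0) (hs : ∀ v w, B v w = B w v)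
    (α β : EuclideanSpace ℝ (Fin n) →ₗ[ℝ] ℝ) (h k : EuclideanSpace ℝ (Fin n)) :
    metricTrace B (fun s t => (α s + B h s) * (β t + B k t)) =
      metricTrace B (fun s t => α s * β t) + α k + β h + B h k := by
  have e : (fun s t => (α s + B h s) * (β t + B k t)) = fun s t =>
      ((α s * β t + α s * B k t) + B h s * β t) + B h s * B k t := by ext s t; ring
  rw [e, metricTrace_add, metricTrace_add, metricTrace_add, metricTrace_flat_right hB hs,
    metricTrace_flat_left hB, hs h k]
  exact congrArg _ (metricTrace_flat_left hB h (B k).toLinearMap)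

end Contraction

section CurvaturePullback

variable {G G' : EuclideanSpace ℝ (Fin n) →
    EuclideanSpace ℝ (Fin n) →L[ℝ] EuclideanSpace ℝ (Fin n) →L[ℝ] ℝ}
  {φ : EuclideanSpace ℝ (Fin n) → EuclideanSpace ℝ (Fin n)} {x : EuclideanSpace ℝ (Fin n)}

/-- The Riemann curvature is natural: the terms in the second and third derivatives of `φ` in the
transformation law of Christoffel's symbols cancel. -/
lemma curvatureForm_pullback (hG : ContDiffAt ℝ 2 G x) (hG' : ContDiffAt ℝ 2 G' (φ x))
    (hφ : ContDiffAt ℝ 3 φ x) (hs : ∀ᶠ y in 𝓝 (φ x), ∀ u v, G' y u v = G' y v u)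
    (h : ∀ᶠ y in 𝓝 x, ∀ u v, G y u v = G' (φ y) (fderiv ℝ φ y u) (fderiv ℝ φ y v))
    (hB : ∀ v, (∀ w, G' (φ x) v w = 0) → v = 0)
    (J : EuclideanSpace ℝ (Fin n) ≃L[ℝ] EuclideanSpace ℝ (Fin n)) (hJ : ∀ v, J v = fderiv ℝ φ x v)
    (u v w z : EuclideanSpace ℝ (Fin n)) :
    curvatureForm G x u v w z = curvatureForm G' (φ x) (J u) (J v) (J w) (J z) := by
  have hsx := hs.self_of_nhds
  have hsym : ∀ u v, fderiv ℝ (fderiv ℝ φ) x u v = fderiv ℝ (fderiv ℝ φ) x v u :=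
    fun u v => ((hφ.of_le (by norm_num : (2 : WithTop ℕ∞) ≤ 3)).isSymmSndFDerivAt (by simp)).eq u v
  have hφ' : ContDiffAt ℝ 2 (fderiv ℝ φ) x := hφ.fderiv_right (by norm_num)
  have hsym3 : fderiv ℝ (fderiv ℝ (fderiv ℝ φ)) x u v = fderiv ℝ (fderiv ℝ (fderiv ℝ φ)) x v u :=
    (hφ'.isSymmSndFDerivAt (by simp)).eq u v
  have hΓ := christoffelForm_pullback (hG.differentiableAt (by norm_num))
    (hG'.differentiableAt (by norm_num)) (hφ.of_le (by norm_num)) hsx h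
  -- the transformation law of the contractions of two Christoffel symbols
  have hc : ∀ a b c d : EuclideanSpace ℝ (Fin n),
      metricTrace (G x) (fun s t => christoffelForm G x a b s * christoffelForm G x c d t) =
      metricTrace (G' (φ x)) (fun s t => christoffelForm G' (φ x) (J a) (J b) s *
        christoffelForm G' (φ x) (J c) (J d) t)
      + christoffelForm G' (φ x) (J a) (J b) (fderiv ℝ (fderiv ℝ φ) x c d)
      + christoffelForm G' (φ x) (J c) (J d) (fderiv ℝ (fderiv ℝ φ) x a b)
      + G' (φ x) (fderiv ℝ (fderiv ℝ φ) x a b) (fderiv ℝ (fderiv ℝ φ) x c d) := by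
    intro a b c d
    have h1 := metricTrace_add_flat hB hsx (christoffelLin G' (φ x) (J a) (J b))
      (christoffelLin G' (φ x) (J c) (J d)) (fderiv ℝ (fderiv ℝ φ) x a b)
      (fderiv ℝ (fderiv ℝ φ) x c d)
    simp only [christoffelLin_apply] at h1
    rw [← h1]
    refine metricTrace_pullback
      ((christoffelLin G' (φ x) (J a) (J b) +
        (G' (φ x) (fderiv ℝ (fderiv ℝ φ) x a b)).toLinearMap).smulRight
      (christoffelLin G' (φ x) (J c) (J d) +
        (G' (φ x) (fderiv ℝ (fderiv ℝ φ) x c d)).toLinearMap)) J ?_ ?_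
    · intro u v; rw [hJ, hJ]; exact h.self_of_nhds u v
    · intro s t; simp [hΓ, hJ]; ring
  -- the metric is parallel
  have compat : ∀ a b c, christoffelForm G' (φ x) a b c + christoffelForm G' (φ x) a c b =
      fderiv ℝ G' (φ x) a b c := by
    intro a b c
    have := fderiv_metric_symm hs (hG'.differentiableAt (by norm_num))
    simp only [christoffelForm]
    rw [this a c b, this c b a, this b a c]
    ring
  have e1 := compat (J v) (fderiv ℝ (fderiv ℝ φ) x u w) (J z)
  have e2 := compat (J u) (fderiv ℝ (fderiv ℝ φ) x v w) (J z)
  rw [curvatureForm, curvatureForm, hc, hc, fderiv_christoffelForm_pullback hG hG' hφ hs h,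
    fderiv_christoffelForm_pullback hG hG' hφ hs h, hsym v u, hsym3]
  simp only [← hJ]
  rw [hsx (fderiv ℝ (fderiv ℝ φ) x u w), hsx (fderiv ℝ (fderiv ℝ φ) x v w)]
  linarith

lemma curvatureForm_swap (x u v w z : EuclideanSpace ℝ (Fin n)) :
    curvatureForm G x v u w z = - curvatureForm G x u v w z := by
  simp only [curvatureForm]; ring

lemma curvatureForm_linear₁ (hG : ContDiffAt ℝ 2 G x) (a : ℝ)
    (u u' v w z : EuclideanSpace ℝ (Fin n)) :
    curvatureForm G x (a • u + u') v w z =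
      a * curvatureForm G x u v w z + curvatureForm G x u' v w z := by
  simp only [curvatureForm, fderiv_christoffelForm hG]
  simp only [christoffelForm_linear_left, metricTrace_linear_left,
    metricTrace_linear_right, map_add, map_smul,
    add_apply, smul_apply, smul_eq_mul]
  ring

lemma curvatureForm_linear₂ (hG : ContDiffAt ℝ 2 G x) (a : ℝ)
    (u v v' w z : EuclideanSpace ℝ (Fin n)) :
    curvatureForm G x u (a • v + v') w z =
      a * curvatureForm G x u v w z + curvatureForm G x u v' w z := by
  rw [curvatureForm_swap, curvatureForm_linear₁ hG, curvatureForm_swap x u v,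
    curvatureForm_swap x u v']
  ring

lemma curvatureForm_linear₃ (hG : ContDiffAt ℝ 2 G x) (a : ℝ)
    (u v w w' z : EuclideanSpace ℝ (Fin n)) :
    curvatureForm G x u v (a • w + w') z =
      a * curvatureForm G x u v w z + curvatureForm G x u v w' z := by
  simp only [curvatureForm, fderiv_christoffelForm hG]
  simp only [christoffelForm_linear_middle, metricTrace_linear_left, map_add, map_smul,
    add_apply, smul_apply, smul_eq_mul]
  ring

lemma curvatureForm_linear₄ (hG : ContDiffAt ℝ 2 G x) (a : ℝ)
    (u v w z z' : EuclideanSpace ℝ (Fin n)) :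
    curvatureForm G x u v w (a • z + z') =
      a * curvatureForm G x u v w z + curvatureForm G x u v w z' := by
  simp only [curvatureForm, fderiv_christoffelForm hG]
  simp only [christoffelForm_linear_middle,
    metricTrace_linear_right, map_add, map_smul,
    add_apply, smul_apply, smul_eq_mul]
  ring

/-- A function of two variables that is linear in each, as a bilinear form. -/
def bilinOfLinear (f : V → V → ℝ) (h₁ : ∀ (a : ℝ) u u' v, f (a • u + u') v = a * f u v + f u' v)
    (h₂ : ∀ (a : ℝ) u v v', f u (a • v + v') = a * f u v + f u v') : V →ₗ[ℝ] V →ₗ[ℝ] ℝ :=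
  have z₁ : ∀ v, f 0 v = 0 := fun v => by have := h₁ 1 0 0 v; simp at this; exact this
  have z₂ : ∀ u, f u 0 = 0 := fun u => by have := h₂ 1 u 0 0; simp at this; exact this
  LinearMap.mk₂ ℝ f (fun u u' v => by simpa using h₁ 1 u u' v)
    (fun a u v => by simpa [z₁] using h₁ a u 0 v) (fun u v v' => by simpa using h₂ 1 u v v')
    (fun a u v => by simpa [z₂] using h₂ a u v 0)

/-- The Ricci curvature is natural. -/
lemma ricciForm_pullback (hG : ContDiffAt ℝ 2 G x) (hG' : ContDiffAt ℝ 2 G' (φ x))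
    (hφ : ContDiffAt ℝ 3 φ x) (hs : ∀ᶠ y in 𝓝 (φ x), ∀ u v, G' y u v = G' y v u)
    (h : ∀ᶠ y in 𝓝 x, ∀ u v, G y u v = G' (φ y) (fderiv ℝ φ y u) (fderiv ℝ φ y v))
    (hB : ∀ v, (∀ w, G' (φ x) v w = 0) → v = 0)
    (J : EuclideanSpace ℝ (Fin n) ≃L[ℝ] EuclideanSpace ℝ (Fin n)) (hJ : ∀ v, J v = fderiv ℝ φ x v)
    (u v : EuclideanSpace ℝ (Fin n)) :
    ricciForm G x u v = ricciForm G' (φ x) (J u) (J v) := by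
  refine metricTrace_pullback
    (bilinOfLinear (fun s t => curvatureForm G' (φ x) (J u) s (J v) t) ?_ ?_) J ?_ ?_
  · exact fun a s s' t => curvatureForm_linear₂ hG' a _ _ _ _ _
  · exact fun a s t t' => curvatureForm_linear₄ hG' a _ _ _ _ _
  · intro s t; rw [hJ, hJ]; exact h.self_of_nhds s t
  · exact fun s t => curvatureForm_pullback hG hG' hφ hs h hB J hJ u s v t

lemma ricciForm_linear_left (hG : ContDiffAt ℝ 2 G x) (a : ℝ) (u u' v : EuclideanSpace ℝ (Fin n)) :
    ricciForm G x (a • u + u') v = a * ricciForm G x u v + ricciForm G x u' v := by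
  simp only [ricciForm, curvatureForm_linear₁ hG, metricTrace_add, metricTrace_const_mul]

lemma ricciForm_linear_right (hG : ContDiffAt ℝ 2 G x) (a : ℝ) (u v v' : EuclideanSpace ℝ (Fin n)) :
    ricciForm G x u (a • v + v') = a * ricciForm G x u v + ricciForm G x u v' := by
  simp only [ricciForm, curvatureForm_linear₃ hG, metricTrace_add, metricTrace_const_mul]

end CurvaturePullback

end

/-! ### Smoothness, and curvature of a rescaled metric -/

section

variable {n : ℕ} {V : Type*} [NormedAddCommGroup V] [NormedSpace ℝ V]

section Smoothness

variable {x : V}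

lemma contDiffAt_det {A : V → Matrix (Fin n) (Fin n) ℝ}
    (hA : ∀ a b, ContDiffAt ℝ ∞ (fun y => A y a b) x) : ContDiffAt ℝ ∞ (fun y => (A y).det) x := by
  simp only [Matrix.det_apply]
  exact ContDiffAt.sum fun τ _ => (contDiffAt_prod fun i _ => hA _ _).const_smul _

lemma contDiffAt_matrix_inv {A : V → Matrix (Fin n) (Fin n) ℝ}
    (hA : ∀ a b, ContDiffAt ℝ ∞ (fun y => A y a b) x) (hdet : IsUnit (A x).det) (s t : Fin n) :
    ContDiffAt ℝ ∞ (fun y => (A y)⁻¹ s t) x := by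
  simp only [Matrix.inv_def, Matrix.smul_apply, Ring.inverse_eq_inv', smul_eq_mul,
    Matrix.adjugate_apply]
  refine ((contDiffAt_det hA).inv hdet.ne_zero).mul (contDiffAt_det fun a b => ?_)
  by_cases h : a = t
  · subst h; simpa using contDiffAt_const
  · simpa [Matrix.updateRow_ne h] using hA a b

lemma contDiffAt_metricTrace
    {B : V → EuclideanSpace ℝ (Fin n) →L[ℝ] EuclideanSpace ℝ (Fin n) →L[ℝ] ℝ}
    {f : V → EuclideanSpace ℝ (Fin n) → EuclideanSpace ℝ (Fin n) → ℝ}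
    (hB : ContDiffAt ℝ ∞ B x) (hnd : ∀ v, (∀ w, B x v w = 0) → v = 0)
    (hf : ∀ s t, ContDiffAt ℝ ∞ (fun y => f y s t) x) :
    ContDiffAt ℝ ∞ (fun y => metricTrace (B y) (f y)) x := by
  refine ContDiffAt.sum fun s _ => ContDiffAt.sum fun t _ => ContDiffAt.mul ?_ (hf _ _)
  refine contDiffAt_matrix_inv (A := fun y => gram (B y)) (fun a b => ?_)
    (isUnit_det_gram hnd) s t
  exact (hB.clm_apply contDiffAt_const).clm_apply contDiffAt_const

lemma contDiffAt_fderiv_apply {W : Type*} [NormedAddCommGroup W] [NormedSpace ℝ W] {f : V → W}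
    (hf : ContDiffAt ℝ ∞ f x) (u : V) :
    ContDiffAt ℝ ∞ (fun y => fderiv ℝ f y u) x :=
  (hf.fderiv_right (m := ∞) (by simp)).clm_apply contDiffAt_const

lemma contDiffAt_christoffelForm {G : V → V →L[ℝ] V →L[ℝ] ℝ} (hG : ContDiffAt ℝ ∞ G x) {u v w :
    V → V}
    (hu : ContDiffAt ℝ ∞ u x) (hv : ContDiffAt ℝ ∞ v x) (hw : ContDiffAt ℝ ∞ w x) :
    ContDiffAt ℝ ∞ (fun y => christoffelForm G y (u y) (v y) (w y)) x := by
  have hd : ContDiffAt ℝ ∞ (fderiv ℝ G) x := hG.fderiv_right (by simp)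
  have h3 : ∀ {u v w : V → V}, ContDiffAt ℝ ∞ u x → ContDiffAt ℝ ∞ v x → ContDiffAt ℝ ∞ w x →
      ContDiffAt ℝ ∞ (fun y => fderiv ℝ G y (u y) (v y) (w y)) x :=
    fun hu hv hw => ((hd.clm_apply hu).clm_apply hv).clm_apply hw
  exact contDiffAt_const.mul (((h3 hu hv hw).add (h3 hv hw hu)).sub (h3 hw hu hv))

end Smoothness

section Rescaling

/-- The form `θ` for which Christoffel's symbols of `σ² G` are `σ θ`. -/
def rescaledChristoffel (G : V → V →L[ℝ] V →L[ℝ] ℝ) (σ : V → ℝ) (x u v w : V) : ℝ :=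
  σ x * christoffelForm G x u v w
    + (fderiv ℝ σ x u * G x v w + fderiv ℝ σ x v * G x u w - fderiv ℝ σ x w * G x u v)

lemma christoffelForm_rescale {G : V → V →L[ℝ] V →L[ℝ] ℝ} {σ : V → ℝ} {x : V}
    (hG : DifferentiableAt ℝ G x) (hσ : DifferentiableAt ℝ σ x)
    (hs : ∀ u v, G x u v = G x v u) (u v w : V) :
    christoffelForm (fun y => σ y ^ 2 • G y) x u v w = σ x * rescaledChristoffel G σ x u v w := by
  have h := ((hσ.hasFDerivAt.pow 2).smul hG.hasFDerivAt).fderiv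
  have h' : fderiv ℝ (fun y => σ y ^ 2 • G y) x = _ := h
  simp only [christoffelForm, rescaledChristoffel, h']
  simp
  rw [hs w u]
  ring

/-- The expression for the Riemann curvature of `σ² G` with the powers of `σ` in its contractions
cancelled, so that it makes sense also where `σ` vanishes. -/
def rescaledCurvature
    (G : EuclideanSpace ℝ (Fin n) → EuclideanSpace ℝ (Fin n) →L[ℝ] EuclideanSpace ℝ (Fin n) →L[ℝ] ℝ)
    (σ : EuclideanSpace ℝ (Fin n) → ℝ) (x u v w z : EuclideanSpace ℝ (Fin n)) : ℝ :=
  fderiv ℝ (fun y => christoffelForm (fun y => σ y ^ 2 • G y) y v w z) x u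
    - fderiv ℝ (fun y => christoffelForm (fun y => σ y ^ 2 • G y) y u w z) x v
    + metricTrace (G x) (fun s t => rescaledChristoffel G σ x u w s * rescaledChristoffel G σ x v
    z t)
    - metricTrace (G x) (fun s t => rescaledChristoffel G σ x v w s * rescaledChristoffel G σ x u
    z t)

/-- The trace with respect to `G` of the curvature of `σ² G`, which is `σ²` times the Ricci
curvature of `σ² G` where `σ` does not vanish. -/
def rescaledRicci
    (G : EuclideanSpace ℝ (Fin n) → EuclideanSpace ℝ (Fin n) →L[ℝ] EuclideanSpace ℝ (Fin n) →L[ℝ] ℝ)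
    (σ : EuclideanSpace ℝ (Fin n) → ℝ) (x u v : EuclideanSpace ℝ (Fin n)) : ℝ :=
  metricTrace (G x) fun s t => rescaledCurvature G σ x u s v t

lemma metricTrace_congr (B : EuclideanSpace ℝ (Fin n) →L[ℝ] EuclideanSpace ℝ (Fin n) →L[ℝ] ℝ)
    {f f' : EuclideanSpace ℝ (Fin n) → EuclideanSpace ℝ (Fin n) → ℝ} (h : ∀ s t, f s t = f' s t) :
    metricTrace B f = metricTrace B f' :=
  congrArg _ (funext fun s => funext (h s))

variable {G : EuclideanSpace ℝ (Fin n) →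
    EuclideanSpace ℝ (Fin n) →L[ℝ] EuclideanSpace ℝ (Fin n) →L[ℝ] ℝ}
  {σ : EuclideanSpace ℝ (Fin n) → ℝ} {x : EuclideanSpace ℝ (Fin n)}

lemma curvatureForm_rescale (hG : DifferentiableAt ℝ G x) (hσ : DifferentiableAt ℝ σ x)
    (hs : ∀ u v, G x u v = G x v u) (h0 : σ x ≠ 0) (u v w z : EuclideanSpace ℝ (Fin n)) :
    curvatureForm (fun y => σ y ^ 2 • G y) x u v w z = rescaledCurvature G σ x u v w z := by
  have hc : ∀ a b c d, metricTrace (σ x ^ 2 • G x) (fun s t =>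
      christoffelForm (fun y => σ y ^ 2 • G y) x a b s *
        christoffelForm (fun y => σ y ^ 2 • G y) x c d t) =
      metricTrace (G x) fun s t =>
        rescaledChristoffel G σ x a b s * rescaledChristoffel G σ x c d t := by
    intro a b c d
    rw [metricTrace_smul_metric _ (pow_ne_zero 2 h0), ← metricTrace_const_mul]
    refine metricTrace_congr _ fun s t => ?_
    rw [christoffelForm_rescale hG hσ hs, christoffelForm_rescale hG hσ hs]
    field_simp
  rw [curvatureForm, rescaledCurvature, hc, hc]

lemma rescaledRicci_eq (hG : DifferentiableAt ℝ G x) (hσ : DifferentiableAt ℝ σ x)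
    (hs : ∀ u v, G x u v = G x v u) (h0 : σ x ≠ 0) (u v : EuclideanSpace ℝ (Fin n)) :
    rescaledRicci G σ x u v = σ x ^ 2 * ricciForm (fun y => σ y ^ 2 • G y) x u v := by
  rw [ricciForm, metricTrace_smul_metric _ (pow_ne_zero 2 h0), mul_inv_cancel_left₀
    (pow_ne_zero 2 h0)]
  exact metricTrace_congr _ fun s t => (curvatureForm_rescale hG hσ hs h0 _ _ _ _).symm

lemma contDiffAt_rescaledChristoffel {G : V → V →L[ℝ] V →L[ℝ] ℝ} {σ : V → ℝ} {x : V}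
    (hG : ContDiffAt ℝ ∞ G x) (hσ : ContDiffAt ℝ ∞ σ x) {u v : V → V}
    (hu : ContDiffAt ℝ ∞ u x) (hv : ContDiffAt ℝ ∞ v x) (w : V) :
    ContDiffAt ℝ ∞ (fun y => rescaledChristoffel G σ y (u y) (v y) w) x := by
  have hw : ContDiffAt ℝ ∞ (fun _ : V => w) x := contDiffAt_const
  have hd : ContDiffAt ℝ ∞ (fderiv ℝ σ) x := hσ.fderiv_right (by simp)
  have h2 : ∀ {u v : V → V}, ContDiffAt ℝ ∞ u x → ContDiffAt ℝ ∞ v x →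
      ContDiffAt ℝ ∞ (fun y => G y (u y) (v y)) x :=
    fun hu hv => (hG.clm_apply hu).clm_apply hv
  exact (hσ.mul (contDiffAt_christoffelForm hG hu hv hw)).add
    ((((hd.clm_apply hu).mul (h2 hv hw)).add ((hd.clm_apply hv).mul (h2 hu hw))).sub
      ((hd.clm_apply hw).mul (h2 hu hv)))

lemma contDiffAt_rescaledRicci (hG : ContDiffAt ℝ ∞ G x) (hσ : ContDiffAt ℝ ∞ σ x)
    (hnd : ∀ v, (∀ w, G x v w = 0) → v = 0) (u v : EuclideanSpace ℝ (Fin n)) :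
    ContDiffAt ℝ ∞ (fun y => rescaledRicci G σ y u v) x := by
  have hc : ∀ u : EuclideanSpace ℝ (Fin n), ContDiffAt ℝ ∞ (fun _ : EuclideanSpace ℝ (Fin n) =>
      u) x :=
    fun u => contDiffAt_const
  have hθ : ∀ a b c d : EuclideanSpace ℝ (Fin n), ContDiffAt ℝ ∞ (fun y => metricTrace
      (G y) fun s t =>
      rescaledChristoffel G σ y a b s * rescaledChristoffel G σ y c d t) x := fun a b c d =>
    contDiffAt_metricTrace hG hnd fun s t =>
      (contDiffAt_rescaledChristoffel hG hσ (hc a) (hc b) s).mul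
        (contDiffAt_rescaledChristoffel hG hσ (hc c) (hc d) t)
  have hσG : ContDiffAt ℝ ∞ (fun y => σ y ^ 2 • G y) x := (hσ.pow 2).smul hG
  exact contDiffAt_metricTrace hG hnd fun s t =>
    (((contDiffAt_fderiv_apply (contDiffAt_christoffelForm hσG (hc _) (hc _) (hc _)) _).sub
      (contDiffAt_fderiv_apply (contDiffAt_christoffelForm hσG (hc _) (hc _) (hc _)) _)).add
      (hθ _ _ _ _)).sub (hθ _ _ _ _)

end Rescaling

end

/-! ### Metrics and vector fields in charts -/

section

variable {n : ℕ} {M : Type*} [TopologicalSpace M] [ChartedSpace (EuclideanSpace ℝ (Fin n)) M]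

/-- The derivative at `x` of the inverse of the chart `e`. The tangent space of `ℝⁿ` at `x` is
written
as `ℝⁿ`, so that the values of this map at different points can be compared. -/
def chartSymmDeriv (e : OpenPartialHomeomorph M (EuclideanSpace ℝ (Fin n)))
    (x : EuclideanSpace ℝ (Fin n)) : EuclideanSpace ℝ (Fin n) →L[ℝ] TangentSpace (𝓡 n) (e.symm x) :=
  mfderiv (𝓡 n) (𝓡 n) e.symm x

/-- The field of bilinear forms `g` read in the chart `e`. -/
def localMetric (g : BilinField n M) (e : OpenPartialHomeomorph M (EuclideanSpace ℝ (Fin n)))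
    (x : EuclideanSpace ℝ (Fin n)) :
    EuclideanSpace ℝ (Fin n) →L[ℝ] EuclideanSpace ℝ (Fin n) →L[ℝ] ℝ :=
  ContinuousLinearMap.bilinearComp (E := EuclideanSpace ℝ (Fin n)) (F := EuclideanSpace ℝ (Fin n))
    (g (e.symm x)) (chartSymmDeriv e x) (chartSymmDeriv e x)

/-- The vector field `X` read in the chart `e`, as a function with values in `ℝⁿ`. -/
def localField (e : OpenPartialHomeomorph M (EuclideanSpace ℝ (Fin n)))
    (X : ∀ p : M, TangentSpace (𝓡 n) p) : EuclideanSpace ℝ (Fin n) → EuclideanSpace ℝ (Fin n) :=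
  VectorField.mpullback (𝓡 n) (𝓡 n) e.symm X

lemma localMetric_apply (g : BilinField n M) (e : OpenPartialHomeomorph M (EuclideanSpace ℝ
    (Fin n)))
    (x u v : EuclideanSpace ℝ (Fin n)) :
    localMetric g e x u v = g (e.symm x) (chartSymmDeriv e x u) (chartSymmDeriv e x v) := rfl

variable {e : OpenPartialHomeomorph M (EuclideanSpace ℝ (Fin n))}
  {x : EuclideanSpace ℝ (Fin n)}

lemma mdifferentiable_of_mem_maximalAtlas (he : e ∈ IsManifold.maximalAtlas (𝓡 n) ∞ M) :
    e.MDifferentiable (𝓡 n) (𝓡 n) :=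
  ⟨(contMDiffOn_of_mem_maximalAtlas he).mdifferentiableOn (by simp),
    (contMDiffOn_symm_of_mem_maximalAtlas he).mdifferentiableOn (by simp)⟩

lemma contDiffAt_comp_symm (he : e ∈ IsManifold.maximalAtlas (𝓡 n) ∞ M) (hx : x ∈ e.target)
    {f : M → ℝ} (hf : ContMDiffAt (𝓡 n) 𝓘(ℝ, ℝ) ∞ f (e.symm x)) :
    ContDiffAt ℝ ∞ (f ∘ e.symm) x :=
  contMDiffAt_iff_contDiffAt.1 (hf.comp x (contMDiffAt_symm_of_mem_maximalAtlas he hx))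

lemma isInvertible_chartSymmDeriv (he : e ∈ IsManifold.maximalAtlas (𝓡 n) ∞ M) (hx : x ∈ e.target) :
    (chartSymmDeriv e x).IsInvertible :=
  ⟨(mdifferentiable_of_mem_maximalAtlas he).symm.mfderiv hx, rfl⟩

lemma isInvertible_mfderiv_chart (he : e ∈ IsManifold.maximalAtlas (𝓡 n) ∞ M) {p : M}
    (hp : p ∈ e.source) : (mfderiv (𝓡 n) (𝓡 n) e p).IsInvertible :=
  ⟨(mdifferentiable_of_mem_maximalAtlas he).mfderiv hp, rfl⟩

lemma chartSymmDeriv_localField (he : e ∈ IsManifold.maximalAtlas (𝓡 n) ∞ M) (hx : x ∈ e.target)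
    (X : ∀ p : M, TangentSpace (𝓡 n) p) :
    chartSymmDeriv e x (localField e X x) = X (e.symm x) :=
  (isInvertible_chartSymmDeriv he hx).self_apply_inverse _

lemma localField_eq_iff (he : e ∈ IsManifold.maximalAtlas (𝓡 n) ∞ M) (hx : x ∈ e.target)
    (X : ∀ p : M, TangentSpace (𝓡 n) p) (v : EuclideanSpace ℝ (Fin n)) :
    localField e X x = v ↔ X (e.symm x) = chartSymmDeriv e x v := by
  rw [← chartSymmDeriv_localField he hx X]
  exact ((isInvertible_chartSymmDeriv he hx).injective.eq_iff).symm

lemma mfderiv_chartSymmDeriv (he : e ∈ IsManifold.maximalAtlas (𝓡 n) ∞ M) (hx : x ∈ e.target)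
    (v : EuclideanSpace ℝ (Fin n)) :
    mfderiv (𝓡 n) (𝓡 n) e (e.symm x) (chartSymmDeriv e x v) = v :=
  congrArg (fun l => l v) ((mdifferentiable_of_mem_maximalAtlas he).comp_symm_deriv hx)

lemma chartSymmDeriv_mfderiv (he : e ∈ IsManifold.maximalAtlas (𝓡 n) ∞ M) (hx : x ∈ e.target)
    (v : TangentSpace (𝓡 n) (e.symm x)) :
    chartSymmDeriv e x (mfderiv (𝓡 n) (𝓡 n) e (e.symm x) v) = v := by
  obtain ⟨u, rfl⟩ := (isInvertible_chartSymmDeriv he hx).surjective v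
  exact congrArg _ (mfderiv_chartSymmDeriv he hx u)

lemma localMetric_localField (he : e ∈ IsManifold.maximalAtlas (𝓡 n) ∞ M) (hx : x ∈ e.target)
    (g : BilinField n M) (X Y : ∀ p : M, TangentSpace (𝓡 n) p) :
    localMetric g e x (localField e X x) (localField e Y x) =
      g (e.symm x) (X (e.symm x)) (Y (e.symm x)) := by
  rw [localMetric_apply, chartSymmDeriv_localField he hx, chartSymmDeriv_localField he hx]

lemma coordField_symm (he : e ∈ IsManifold.maximalAtlas (𝓡 n) ∞ M) (hx : x ∈ e.target) (a : Fin n) :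
    coordField e a (e.symm x) = chartSymmDeriv e x (EuclideanSpace.single a 1) := by
  have h := (isInvertible_mfderiv_chart he (e.map_target hx)).injective
  apply h
  refine Eq.trans ?_ (mfderiv_chartSymmDeriv he hx _).symm
  exact (isInvertible_mfderiv_chart he (e.map_target hx)).self_apply_inverse _

lemma localField_coordField (he : e ∈ IsManifold.maximalAtlas (𝓡 n) ∞ M) (hx : x ∈ e.target)
    (a : Fin n) : localField e (coordField e a) x = EuclideanSpace.single a 1 :=
  (localField_eq_iff he hx _ _).2 (coordField_symm he hx a)

/-- The derivative along a vector field in a chart. Here and below, a formula whose name ends in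
`_symm` expresses a quantity at the point `e.symm x` by representatives in the chart `e` at `x`. -/
lemma dirDeriv_symm (he : e ∈ IsManifold.maximalAtlas (𝓡 n) ∞ M) (hx : x ∈ e.target)
    (X : ∀ p : M, TangentSpace (𝓡 n) p) {f : M → ℝ}
    (hf : MDifferentiableAt (𝓡 n) 𝓘(ℝ, ℝ) f (e.symm x)) :
    dirDeriv X f (e.symm x) = fderiv ℝ (f ∘ e.symm) x (localField e X x) := by
  have h := mfderiv_comp x hf ((mdifferentiable_of_mem_maximalAtlas he).mdifferentiableAt_symm hx)
  rw [mfderiv_eq_fderiv] at h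
  rw [h, dirDeriv, ← chartSymmDeriv_localField he hx X]
  rfl

variable [IsManifold (𝓡 n) ∞ M]

lemma contMDiffAt_coordField (he : e ∈ IsManifold.maximalAtlas (𝓡 n) ∞ M) {p : M}
    (hp : p ∈ e.source) (a : Fin n) :
    ContMDiffAt (𝓡 n) (𝓡 n).tangent ∞
      (fun p => (coordField e a p : TangentBundle (𝓡 n) M)) p := by
  refine ContMDiffAt.mpullback_vectorField_preimage (n := ∞) ?_
    (contMDiffAt_of_mem_maximalAtlas he hp) (isInvertible_mfderiv_chart he hp) (by simp)
  exact contMDiffAt_vectorSpace_iff_contDiffAt.2 contDiffAt_const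

lemma contDiffAt_localField (he : e ∈ IsManifold.maximalAtlas (𝓡 n) ∞ M) (hx : x ∈ e.target)
    {X : ∀ p : M, TangentSpace (𝓡 n) p} (hX : ContMDiffAt (𝓡 n) (𝓡 n).tangent ∞
      (fun p => (X p : TangentBundle (𝓡 n) M)) (e.symm x)) :
    ContDiffAt ℝ ∞ (localField e X) x :=
  contMDiffAt_vectorSpace_iff_contDiffAt.1 <|
    ContMDiffAt.mpullback_vectorField_preimage (n := ∞) hX
      (contMDiffAt_symm_of_mem_maximalAtlas he hx) (isInvertible_chartSymmDeriv he hx) (by simp)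

lemma contMDiffAt_metric_apply {g : BilinField n M} (hg : IsSingularMetric g) {p : M}
    {X Y : ∀ p : M, TangentSpace (𝓡 n) p}
    (hX : ContMDiffAt (𝓡 n) (𝓡 n).tangent ∞ (fun p => (X p : TangentBundle (𝓡 n) M)) p)
    (hY : ContMDiffAt (𝓡 n) (𝓡 n).tangent ∞ (fun p => (Y p : TangentBundle (𝓡 n) M)) p) :
    ContMDiffAt (𝓡 n) 𝓘(ℝ, ℝ) ∞ (fun q => g q (X q) (Y q)) p := by
  have : ContMDiffAt (𝓡 n) ((𝓡 n).prod 𝓘(ℝ)) ∞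
      (fun m ↦ Bundle.TotalSpace.mk' ℝ (E := Bundle.Trivial M ℝ) m (g m (X m) (Y m))) p := by
    apply ContMDiffAt.clm_bundle_apply₂ (F₁ := EuclideanSpace ℝ (Fin n))
      (F₂ := EuclideanSpace ℝ (Fin n))
    · exact hg.contMDiff.contMDiffAt
    · exact hX
    · exact hY
  simp only [Bundle.contMDiffAt_totalSpace] at this
  exact this.2

lemma contDiffAt_localMetric {g : BilinField n M} (hg : IsSingularMetric g)
    (he : e ∈ IsManifold.maximalAtlas (𝓡 n) ∞ M) (hx : x ∈ e.target) :
    ContDiffAt ℝ ∞ (localMetric g e) x := by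
  have hab : ∀ a b : Fin n, ContDiffOn ℝ ∞ (fun y => localMetric g e y
      (EuclideanSpace.single a 1) (EuclideanSpace.single b 1)) e.target := fun a b y hy => by
    refine ((contDiffAt_comp_symm he hy (contMDiffAt_metric_apply hg
      (contMDiffAt_coordField he (e.map_target hy) a)
      (contMDiffAt_coordField he (e.map_target hy) b))).congr_of_eventuallyEq
        ?_).contDiffWithinAt
    filter_upwards [e.open_target.mem_nhds hy] with y hy
    rw [localMetric_apply, ← coordField_symm he hy, ← coordField_symm he hy]
    rfl
  have : ContDiffOn ℝ ∞ (localMetric g e) e.target := by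
    refine contDiffOn_clm_apply.2 fun u => contDiffOn_clm_apply.2 fun v => ?_
    have h : (fun y => localMetric g e y u v) = fun y => ∑ a, ∑ b, u a * v b * localMetric g e y
        (EuclideanSpace.single a 1) (EuclideanSpace.single b 1) :=
      funext fun y => bilin_eq_sum ((ContinuousLinearMap.coeLM ℝ).comp
        (localMetric g e y).toLinearMap) u v
    rw [h]
    exact ContDiffOn.sum fun a _ => ContDiffOn.sum fun b _ => contDiffOn_const.mul (hab a b)
  exact this.contDiffAt (e.open_target.mem_nhds hx)

end

/-! ### Changes of charts, and the Koszul form and the curvature in a chart -/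

section

variable {n : ℕ} {M : Type*} [TopologicalSpace M] [ChartedSpace (EuclideanSpace ℝ (Fin n)) M]
variable {e e' : OpenPartialHomeomorph M (EuclideanSpace ℝ (Fin n))}
  {x : EuclideanSpace ℝ (Fin n)}
lemma localMetric_mfderiv (he : e ∈ IsManifold.maximalAtlas (𝓡 n) ∞ M) (g : BilinField n M) {p : M}
    (hp : p ∈ e.source) (v w : TangentSpace (𝓡 n) p) :
    localMetric g e (e p) (mfderiv (𝓡 n) (𝓡 n) e p v) (mfderiv (𝓡 n) (𝓡 n) e p w) = g p v w := by
  obtain ⟨y, hy, rfl⟩ : ∃ y ∈ e.target, e.symm y = p := ⟨e p, e.map_source hp, e.left_inv hp⟩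
  have h : localMetric g e (e (e.symm y)) = localMetric g e y := congrArg _ (e.right_inv hy)
  refine Eq.trans (congrArg (fun B : EuclideanSpace ℝ (Fin n) →L[ℝ] EuclideanSpace ℝ (Fin n) →L[ℝ] ℝ
    => B (mfderiv (𝓡 n) (𝓡 n) e (e.symm y) v) (mfderiv (𝓡 n) (𝓡 n) e (e.symm y) w)) h) ?_
  refine (localMetric_apply g e y _ _).trans ?_
  have h1 := chartSymmDeriv_mfderiv he hy
  exact congrArg₂ (fun a b => g (e.symm y) a b) (h1 v) (h1 w)

section Transition

variable (he : e ∈ IsManifold.maximalAtlas (𝓡 n) ∞ M) (he' : e' ∈ IsManifold.maximalAtlas (𝓡 n) ∞ M)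
  (hx : x ∈ e.target) (hx' : e.symm x ∈ e'.source)
include he he' hx hx'

lemma contDiffAt_transition : ContDiffAt ℝ ∞ (e' ∘ e.symm) x :=
  contMDiffAt_iff_contDiffAt.1 ((contMDiffAt_of_mem_maximalAtlas he' hx').comp x
    (contMDiffAt_symm_of_mem_maximalAtlas he hx))

lemma fderiv_transition (v : EuclideanSpace ℝ (Fin n)) :
    fderiv ℝ (e' ∘ e.symm) x v = mfderiv (𝓡 n) (𝓡 n) e' (e.symm x) (chartSymmDeriv e x v) := by
  have h := mfderiv_comp x ((mdifferentiable_of_mem_maximalAtlas he').mdifferentiableAt hx')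
    ((mdifferentiable_of_mem_maximalAtlas he).mdifferentiableAt_symm hx)
  rw [mfderiv_eq_fderiv] at h
  rw [h]
  rfl

lemma localMetric_transition (g : BilinField n M) (u v : EuclideanSpace ℝ (Fin n)) :
    localMetric g e x u v = localMetric g e' ((e' ∘ e.symm) x)
      (fderiv ℝ (e' ∘ e.symm) x u) (fderiv ℝ (e' ∘ e.symm) x v) := by
  rw [fderiv_transition he he' hx hx', fderiv_transition he he' hx hx']
  exact (localMetric_mfderiv he' g hx' _ _).symm

/-- The representatives of `g` in two charts are related by pullback under the change of charts, in
a neighbourhood of the given point. -/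
lemma eventually_localMetric_transition (g : BilinField n M) : ∀ᶠ y in 𝓝 x, ∀ u v,
    localMetric g e y u v = localMetric g e' ((e' ∘ e.symm) y)
      (fderiv ℝ (e' ∘ e.symm) y u) (fderiv ℝ (e' ∘ e.symm) y v) := by
  filter_upwards [e.open_target.mem_nhds hx,
    (e.continuousAt_symm hx).preimage_mem_nhds (e'.open_source.mem_nhds hx')] with y hy hy'
  exact localMetric_transition he he' hy hy' g

lemma exists_transition_equiv : ∃ J : EuclideanSpace ℝ (Fin n) ≃L[ℝ] EuclideanSpace ℝ (Fin n),
    ∀ v, J v = fderiv ℝ (e' ∘ e.symm) x v := by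
  obtain ⟨A, hA⟩ := isInvertible_chartSymmDeriv he hx
  obtain ⟨B, hB⟩ := isInvertible_mfderiv_chart he' hx'
  refine ⟨A.trans B, fun v => ?_⟩
  rw [fderiv_transition he he' hx hx', ← hA, ← hB]
  rfl

end Transition

lemma metricMatrix_symm (he : e ∈ IsManifold.maximalAtlas (𝓡 n) ∞ M) (hx : x ∈ e.target)
    (g : BilinField n M) :
    metricMatrix g e (e.symm x) = gram (localMetric g e x) := by
  ext a b
  simp only [metricMatrix, gram, Matrix.of_apply, coordField_symm he hx]
  rfl

variable [IsManifold (𝓡 n) ∞ M]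

lemma localMetric_comm {g : BilinField n M} (hg : IsSingularMetric g)
    (u v : EuclideanSpace ℝ (Fin n)) : localMetric g e x u v = localMetric g e x v u :=
  hg.symm _ _ _

lemma localField_mlieBracket (he : e ∈ IsManifold.maximalAtlas (𝓡 n) ∞ M) (hx : x ∈ e.target)
    {X Y : ∀ p : M, TangentSpace (𝓡 n) p}
    (hX : ContMDiffAt (𝓡 n) (𝓡 n).tangent ∞ (fun p => (X p : TangentBundle (𝓡 n) M)) (e.symm x))
    (hY : ContMDiffAt (𝓡 n) (𝓡 n).tangent ∞ (fun p => (Y p : TangentBundle (𝓡 n) M)) (e.symm x)) :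
    localField e (VectorField.mlieBracket (𝓡 n) X Y) x =
      VectorField.lieBracket ℝ (localField e X) (localField e Y) x := by
  have h2 : minSmoothness ℝ 2 ≤ (∞ : WithTop ℕ∞) := by
    rw [minSmoothness_of_isRCLikeNormedField]; exact ENat.LEInfty.out
  have : IsManifold (𝓡 n) (minSmoothness ℝ 2) M := IsManifold.of_le h2
  have h := VectorField.mpullback_mlieBracket (n := ∞) (hX.mdifferentiableAt (by simp))
    (hY.mdifferentiableAt (by simp)) (contMDiffAt_symm_of_mem_maximalAtlas he hx) h2
  refine h.trans ?_
  rw [← VectorField.mlieBracketWithin_univ, ← VectorField.lieBracketWithin_univ]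
  exact congrFun VectorField.mlieBracketWithin_eq_lieBracketWithin x

/-- The Koszul form in a chart: `K(X,Y,Z) = Γ(X,Y,Z) + ⟨∂_X Y, Z⟩`. -/
lemma koszul_symm {g : BilinField n M} (hg : IsSingularMetric g)
    (he : e ∈ IsManifold.maximalAtlas (𝓡 n) ∞ M) (hx : x ∈ e.target)
    {X Y Z : ∀ p : M, TangentSpace (𝓡 n) p}
    (hX : ContMDiffAt (𝓡 n) (𝓡 n).tangent ∞ (fun p => (X p : TangentBundle (𝓡 n) M)) (e.symm x))
    (hY : ContMDiffAt (𝓡 n) (𝓡 n).tangent ∞ (fun p => (Y p : TangentBundle (𝓡 n) M)) (e.symm x))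
    (hZ : ContMDiffAt (𝓡 n) (𝓡 n).tangent ∞ (fun p => (Z p : TangentBundle (𝓡 n) M)) (e.symm x)) :
    koszul g X Y Z (e.symm x) =
      christoffelForm (localMetric g e) x (localField e X x) (localField e Y x) (localField e Z x)
      + localMetric g e x (fderiv ℝ (localField e Y) x (localField e X x)) (localField e Z x) := by
  have hd : ∀ {X Y Z : ∀ p : M, TangentSpace (𝓡 n) p},
    ContMDiffAt (𝓡 n) (𝓡 n).tangent ∞ (fun p => (Y p : TangentBundle (𝓡 n) M)) (e.symm x) →
    ContMDiffAt (𝓡 n) (𝓡 n).tangent ∞ (fun p => (Z p : TangentBundle (𝓡 n) M)) (e.symm x) →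
    dirDeriv X (fun q => g q (Y q) (Z q)) (e.symm x) =
      fderiv ℝ (localMetric g e) x (localField e X x) (localField e Y x) (localField e Z x)
      + localMetric g e x (fderiv ℝ (localField e Y) x (localField e X x)) (localField e Z x)
      + localMetric g e x (fderiv ℝ (localField e Z) x (localField e X x)) (localField e Y x) := by
    intro X Y Z hY hZ
    rw [dirDeriv_symm he hx X ((contMDiffAt_metric_apply hg hY hZ).mdifferentiableAt (by simp))]
    have hev : ((fun q => g q (Y q) (Z q)) ∘ e.symm) =ᶠ[𝓝 x]
        fun y => localMetric g e y (localField e Y y) (localField e Z y) := by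
      filter_upwards [e.open_target.mem_nhds hx] with y hy
      exact (localMetric_localField he hy g Y Z).symm
    have h1 := (contDiffAt_localMetric hg he hx).differentiableAt (by simp) |>.hasFDerivAt
    have h2 := (contDiffAt_localField he hx hY).differentiableAt (by simp) |>.hasFDerivAt
    have h3 := (contDiffAt_localField he hx hZ).differentiableAt (by simp) |>.hasFDerivAt
    rw [(((h1.clm_apply h2).clm_apply h3).congr_of_eventuallyEq hev).fderiv]
    simp
    rw [localMetric_comm hg (localField e Y x)]
    ring
  have hb : ∀ {X Y Z : ∀ p : M, TangentSpace (𝓡 n) p},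
    ContMDiffAt (𝓡 n) (𝓡 n).tangent ∞ (fun p => (Y p : TangentBundle (𝓡 n) M)) (e.symm x) →
    ContMDiffAt (𝓡 n) (𝓡 n).tangent ∞ (fun p => (Z p : TangentBundle (𝓡 n) M)) (e.symm x) →
    g (e.symm x) (X (e.symm x)) (VectorField.mlieBracket (𝓡 n) Y Z (e.symm x)) =
      localMetric g e x (fderiv ℝ (localField e Z) x (localField e Y x)) (localField e X x)
      - localMetric g e x (fderiv ℝ (localField e Y) x (localField e Z x)) (localField e X x) := by
    intro X Y Z hY hZ
    rw [← localMetric_localField he hx, localField_mlieBracket he hx hY hZ,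
      localMetric_comm hg, VectorField.lieBracket, map_sub, sub_apply]
  rw [koszul, hd hY hZ, hd hZ hX, hd hX hY, hb hY hZ, hb hZ hX, hb hX hY, christoffelForm]
  ring

section Components

variable {g : BilinField n M} (hg : IsSingularMetric g)
  (he : e ∈ IsManifold.maximalAtlas (𝓡 n) ∞ M) (hx : x ∈ e.target)
include hg he hx

lemma christoffel_symm (a b c : Fin n) :
    christoffel g e a b c (e.symm x) = christoffelForm (localMetric g e) x
      (EuclideanSpace.single a 1) (EuclideanSpace.single b 1) (EuclideanSpace.single c 1) := by
  have hs := contMDiffAt_coordField he (e.map_target hx)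
  -- coordinate fields have constant representatives
  have h0 : fderiv ℝ (localField e (coordField e b)) x = 0 := by
    have : localField e (coordField e b) =ᶠ[𝓝 x] fun _ => EuclideanSpace.single b 1 := by
      filter_upwards [e.open_target.mem_nhds hx] with y hy
      exact localField_coordField he hy b
    rw [this.fderiv_eq]
    simp
  rw [christoffel, koszul_symm hg he hx (hs a) (hs b) (hs c), h0]
  simp [localField_coordField he hx]

lemma riemann_symm (a b c d : Fin n) :
    riemann g e (e.symm x) a b c d = curvatureForm (localMetric g e) x
      (EuclideanSpace.single a 1) (EuclideanSpace.single b 1) (EuclideanSpace.single c 1)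
      (EuclideanSpace.single d 1) := by
  have hd : ∀ a b c d : Fin n, dirDeriv (coordField e a) (christoffel g e b c d) (e.symm x) =
      fderiv ℝ (fun y => christoffelForm (localMetric g e) y (EuclideanSpace.single b 1)
        (EuclideanSpace.single c 1) (EuclideanSpace.single d 1)) x (EuclideanSpace.single a 1) := by
    intro a b c d
    have hΓ := contDiffAt_christoffelForm (contDiffAt_localMetric hg he hx)
      (contDiffAt_const (c := EuclideanSpace.single b (1 : ℝ)))
      (contDiffAt_const (c := EuclideanSpace.single c (1 : ℝ)))
      (contDiffAt_const (c := EuclideanSpace.single d (1 : ℝ)))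
    have hm : MDifferentiableAt (𝓡 n) 𝓘(ℝ, ℝ) (christoffel g e b c d) (e.symm x) := by
      have hΓ' := hΓ.contMDiffAt.mdifferentiableAt (by simp)
      rw [← e.right_inv hx] at hΓ'
      refine (hΓ'.comp (e.symm x) ((mdifferentiable_of_mem_maximalAtlas he).mdifferentiableAt
        (e.map_target hx))).congr_of_eventuallyEq ?_
      filter_upwards [e.open_source.mem_nhds (e.map_target hx)] with q hq
      simp only [Function.comp_apply]
      rw [← christoffel_symm hg he (e.map_source hq), e.left_inv hq]
    rw [dirDeriv_symm he hx _ hm, localField_coordField he hx]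
    congr 1
    refine Filter.EventuallyEq.fderiv_eq ?_
    filter_upwards [e.open_target.mem_nhds hx] with y hy
    exact christoffel_symm hg he hy b c d
  rw [riemann, hd, hd, curvatureForm]
  simp only [christoffelContraction, christoffel_symm hg he hx, invMetric, metricMatrix_symm he hx,
    metricTrace, mul_assoc]

lemma ricci_symm (a b : Fin n) :
    ricci g e (e.symm x) a b = ricciForm (localMetric g e) x
      (EuclideanSpace.single a 1) (EuclideanSpace.single b 1) := by
  simp only [ricci, riemann_symm hg he hx, invMetric, metricMatrix_symm he hx, ricciForm,
    metricTrace]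

lemma scalarCurvature_symm :
    scalarCurvature g e (e.symm x) = metricTrace (localMetric g e x) (ricciForm
    (localMetric g e) x) := by
  simp only [scalarCurvature, ricci_symm hg he hx, invMetric, metricMatrix_symm he hx, metricTrace]

end Components

end

/-! ### The Koszul form of a conformally rescaled metric -/

section

variable {n : ℕ} {M : Type*} [TopologicalSpace M] [ChartedSpace (EuclideanSpace ℝ (Fin n)) M]
variable {e : OpenPartialHomeomorph M (EuclideanSpace ℝ (Fin n))}
  {x : EuclideanSpace ℝ (Fin n)} {g : BilinField n M} {Ω : M → ℝ}

lemma localMetric_conformalRescaling (g : BilinField n M) (Ω : M → ℝ)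
    (e : OpenPartialHomeomorph M (EuclideanSpace ℝ (Fin n))) :
    localMetric (conformalRescaling Ω g) e = fun y => (Ω ∘ e.symm) y ^ 2 • localMetric g e y := rfl

lemma conformalRescaling_apply (Ω : M → ℝ) (g : BilinField n M) (p : M)
    (v w : TangentSpace (𝓡 n) p) : conformalRescaling Ω g p v w = Ω p ^ 2 * g p v w := rfl

lemma NondegenerateAt.rescale {p : M} (hg : NondegenerateAt g p) (h0 : Ω p ≠ 0) :
    NondegenerateAt (conformalRescaling Ω g) p := by
  intro v hv
  refine hg v fun w => ?_
  have := hv w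
  rw [conformalRescaling_apply] at this
  exact (mul_eq_zero.1 this).resolve_left (pow_ne_zero 2 h0)

/-- In positive dimension, `Ω² g` is degenerate at the zeros of `Ω`. -/
lemma NondegenerateAt.conformal_factor_ne_zero [NeZero n] {p : M}
    (h : NondegenerateAt (conformalRescaling Ω g) p) : Ω p ≠ 0 := by
  intro h0
  have h1 : ∀ v : TangentSpace (𝓡 n) p, v = 0 := fun v =>
    h v fun w => by rw [conformalRescaling_apply, h0]; simp
  have h2 : (EuclideanSpace.single 0 1 : EuclideanSpace ℝ (Fin n)) = 0 := h1 _
  simp at h2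

/-- The expression `θ` for which the Koszul form of `Ω² g` is `Ω θ`. -/
def rescaledKoszul (g : BilinField n M) (Ω : M → ℝ) (X Y Z : ∀ p : M, TangentSpace (𝓡 n) p)
    (p : M) : ℝ :=
  Ω p * koszul g X Y Z p + (dirDeriv X Ω p * g p (Y p) (Z p) + dirDeriv Y Ω p * g p (X p) (Z p)
    - dirDeriv Z Ω p * g p (X p) (Y p))

/-- The one-form `θ(X,Y,_)` read in a chart, in terms of the representatives of the metric, of the
conformal factor and of the vector fields. -/
def localRescaledKoszul
    (G : EuclideanSpace ℝ (Fin n) → EuclideanSpace ℝ (Fin n) →L[ℝ] EuclideanSpace ℝ (Fin n) →L[ℝ] ℝ)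
    (σ : EuclideanSpace ℝ (Fin n) → ℝ) (X Y : EuclideanSpace ℝ (Fin n) → EuclideanSpace ℝ (Fin n))
    (y w : EuclideanSpace ℝ (Fin n)) : ℝ :=
  rescaledChristoffel G σ y (X y) (Y y) w + σ y * G y (fderiv ℝ Y y (X y)) w

lemma contDiffAt_localRescaledKoszul
    {G : EuclideanSpace ℝ (Fin n) → EuclideanSpace ℝ (Fin n) →L[ℝ] EuclideanSpace ℝ (Fin n) →L[ℝ] ℝ}
    {σ : EuclideanSpace ℝ (Fin n) → ℝ} {X Y : EuclideanSpace ℝ (Fin n) → EuclideanSpace ℝ (Fin n)}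
    (hG : ContDiffAt ℝ ∞ G x) (hσ : ContDiffAt ℝ ∞ σ x) (hX : ContDiffAt ℝ ∞ X x)
    (hY : ContDiffAt ℝ ∞ Y x) (w : EuclideanSpace ℝ (Fin n)) :
    ContDiffAt ℝ ∞ (fun y => localRescaledKoszul G σ X Y y w) x :=
  (contDiffAt_rescaledChristoffel hG hσ hX hY w).add
    (hσ.mul ((hG.clm_apply ((hY.fderiv_right (m := ∞) (by simp)).clm_apply hX)).clm_apply
      contDiffAt_const))

/-- `localRescaledKoszul` as a linear form. -/
def localRescaledKoszulLin
    (G : EuclideanSpace ℝ (Fin n) → EuclideanSpace ℝ (Fin n) →L[ℝ] EuclideanSpace ℝ (Fin n) →L[ℝ] ℝ)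
    (σ : EuclideanSpace ℝ (Fin n) → ℝ) (X Y : EuclideanSpace ℝ (Fin n) → EuclideanSpace ℝ (Fin n))
    (y : EuclideanSpace ℝ (Fin n)) : EuclideanSpace ℝ (Fin n) →ₗ[ℝ] ℝ where
  toFun := localRescaledKoszul G σ X Y y
  map_add' a b := by simp [localRescaledKoszul, rescaledChristoffel, christoffelForm]; ring
  map_smul' a b := by simp [localRescaledKoszul, rescaledChristoffel, christoffelForm]; ring

/-- On a finite-dimensional space, every linear form is `v♭` for some `v` if the bilinear form is
non-degenerate. -/
lemma exists_eq_of_nondegenerate {V : Type*} [AddCommGroup V] [Module ℝ V] [FiniteDimensional ℝ V]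
    (B : V →ₗ[ℝ] V →ₗ[ℝ] ℝ) (hB : ∀ v, (∀ w, B v w = 0) → v = 0) (β : V →ₗ[ℝ] ℝ) :
    ∃ v, ∀ w, B v w = β w := by
  have hinj : Function.Injective B := (injective_iff_map_eq_zero B).2 fun v hv =>
    hB v fun w => by rw [hv]; rfl
  have hsurj : Function.Surjective B :=
    (LinearMap.injective_iff_surjective_of_finrank_eq_finrank
      (Subspace.dual_finrank_eq (K := ℝ) (V := V)).symm).1 hinj
  obtain ⟨v, hv⟩ := hsurj β
  exact ⟨v, fun w => by rw [hv]⟩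

lemma localMetric_nondegenerate (he : e ∈ IsManifold.maximalAtlas (𝓡 n) ∞ M) (hx : x ∈ e.target)
    (h : NondegenerateAt g (e.symm x)) (v : EuclideanSpace ℝ (Fin n))
    (hv : ∀ w, localMetric g e x v w = 0) : v = 0 := by
  have hi := isInvertible_chartSymmDeriv he hx
  refine (map_eq_zero_iff _ hi.injective).1 (h (chartSymmDeriv e x v) fun w => ?_)
  obtain ⟨u, rfl⟩ := hi.surjective w
  exact hv u

variable [IsManifold (𝓡 n) ∞ M]

lemma IsSingularMetric.rescale (hg : IsSingularMetric g)
    (hΩ : ContMDiff (𝓡 n) 𝓘(ℝ, ℝ) ∞ Ω) : IsSingularMetric (conformalRescaling Ω g) where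
  symm p v w := by rw [conformalRescaling_apply, conformalRescaling_apply, hg.symm]
  contMDiff := ContMDiff.smul_section (hΩ.pow 2) hg.contMDiff

section Koszul

variable {X Y Z : ∀ p : M, TangentSpace (𝓡 n) p}

lemma rescaledKoszul_symm (hg : IsSingularMetric g) (hΩ : ContMDiff (𝓡 n) 𝓘(ℝ, ℝ) ∞ Ω)
    (he : e ∈ IsManifold.maximalAtlas (𝓡 n) ∞ M) (hx : x ∈ e.target)
    (hX : ContMDiffAt (𝓡 n) (𝓡 n).tangent ∞ (fun p => (X p : TangentBundle (𝓡 n) M)) (e.symm x))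
    (hY : ContMDiffAt (𝓡 n) (𝓡 n).tangent ∞ (fun p => (Y p : TangentBundle (𝓡 n) M)) (e.symm x))
    (hZ : ContMDiffAt (𝓡 n) (𝓡 n).tangent ∞ (fun p => (Z p : TangentBundle (𝓡 n) M)) (e.symm x)) :
    rescaledKoszul g Ω X Y Z (e.symm x) = localRescaledKoszulLin (localMetric g e) (Ω ∘ e.symm)
      (localField e X) (localField e Y) x (localField e Z x) := by
  have hΩ' : MDifferentiableAt (𝓡 n) 𝓘(ℝ, ℝ) Ω (e.symm x) := hΩ.mdifferentiableAt (by simp)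
  rw [rescaledKoszul, koszul_symm hg he hx hX hY hZ, dirDeriv_symm he hx X hΩ',
    dirDeriv_symm he hx Y hΩ', dirDeriv_symm he hx Z hΩ', ← localMetric_localField he hx,
    ← localMetric_localField he hx, ← localMetric_localField he hx]
  change _ = localRescaledKoszul _ _ _ _ _ _
  rw [localRescaledKoszul, rescaledChristoffel, Function.comp_apply]
  ring

lemma koszul_conformalRescaling (hg : IsSingularMetric g) (hΩ : ContMDiff (𝓡 n) 𝓘(ℝ, ℝ) ∞ Ω)
    {p : M} (hX : ContMDiffAt (𝓡 n) (𝓡 n).tangent ∞ (fun p => (X p : TangentBundle (𝓡 n) M)) p)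
    (hY : ContMDiffAt (𝓡 n) (𝓡 n).tangent ∞ (fun p => (Y p : TangentBundle (𝓡 n) M)) p)
    (hZ : ContMDiffAt (𝓡 n) (𝓡 n).tangent ∞ (fun p => (Z p : TangentBundle (𝓡 n) M)) p) :
    koszul (conformalRescaling Ω g) X Y Z p = Ω p * rescaledKoszul g Ω X Y Z p := by
  obtain ⟨e, he, x, hx, rfl⟩ : ∃ e ∈ IsManifold.maximalAtlas (𝓡 n) ∞ M, ∃ x ∈ e.target,
      e.symm x = p := ⟨_, IsManifold.chart_mem_maximalAtlas p, _, mem_chart_target _ p,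
        (chartAt _ p).left_inv (mem_chart_source _ p)⟩
  rw [rescaledKoszul_symm hg hΩ he hx hX hY hZ, koszul_symm (hg.rescale hΩ) he hx hX hY hZ,
    localMetric_conformalRescaling, christoffelForm_rescale
      ((contDiffAt_localMetric hg he hx).differentiableAt (by simp))
      ((contDiffAt_comp_symm he hx hΩ.contMDiffAt).differentiableAt (by simp))
      (localMetric_comm hg)]
  change _ = _ * localRescaledKoszul _ _ _ _ _ _
  simp [localRescaledKoszul]
  ring

/-- Every tangent vector is the value of a smooth local vector field. -/
lemma exists_smoothVectorFieldOn (p : M) (v : TangentSpace (𝓡 n) p) :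
    ∃ (U : Set M) (Z : ∀ p : M, TangentSpace (𝓡 n) p), IsOpen U ∧ p ∈ U ∧
      SmoothVectorFieldOn Z U ∧ Z p = v := by
  have he := IsManifold.chart_mem_maximalAtlas (I := 𝓡 n) (n := ∞) p
  refine ⟨(chartAt (EuclideanSpace ℝ (Fin n)) p).source, VectorField.mpullback (𝓡 n) (𝓡 n)
    (chartAt (EuclideanSpace ℝ (Fin n)) p)
    fun _ => mfderiv (𝓡 n) (𝓡 n) (chartAt (EuclideanSpace ℝ (Fin n)) p) p v,
    (chartAt _ p).open_source, mem_chart_source _ p, fun q hq => ?_, ?_⟩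
  · refine (ContMDiffAt.mpullback_vectorField_preimage (n := ∞) ?_
      (contMDiffAt_of_mem_maximalAtlas he hq) (isInvertible_mfderiv_chart he hq)
      (by simp)).contMDiffWithinAt
    exact contMDiffAt_vectorSpace_iff_contDiffAt.2 contDiffAt_const
  · exact (isInvertible_mfderiv_chart he (mem_chart_source _ p)).inverse_apply_self v

end Koszul

end

/-! ### Semi-regularity of conformal rescalings -/

section

variable {n : ℕ} {M : Type*} [TopologicalSpace M] [ChartedSpace (EuclideanSpace ℝ (Fin n)) M]
variable {g : BilinField n M} {Ω : M → ℝ}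

lemma rankAt_conformalRescaling_of_eq_zero {p : M} (h0 : Ω p = 0) :
    rankAt (conformalRescaling Ω g) p = 0 := by
  have : (conformalRescaling Ω g p).toLinearMap = 0 := by
    ext v w
    simp [conformalRescaling_apply, h0]
  rw [rankAt, this, LinearMap.range_zero, finrank_bot]

lemma NondegenerateAt.rankAt_ne_zero [NeZero n] {p : M} (h : NondegenerateAt g p) :
    rankAt g p ≠ 0 := by
  intro h0
  have : FiniteDimensional ℝ (TangentSpace (𝓡 n) p) :=
    inferInstanceAs (FiniteDimensional ℝ (EuclideanSpace ℝ (Fin n)))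
  have : FiniteDimensional ℝ (LinearMap.range (g p).toLinearMap) :=
    LinearMap.finiteDimensional_range _
  have h1 : LinearMap.range (g p).toLinearMap = ⊥ := Submodule.finrank_eq_zero.1 h0
  have h2 : (g p).toLinearMap = 0 := LinearMap.range_eq_bot.1 h1
  have h3 : ∀ v : TangentSpace (𝓡 n) p, v = 0 := fun v =>
    h v fun w => by
      have : g p v = 0 := congrArg (fun l => l v) h2
      rw [this]; rfl
  have h4 : (EuclideanSpace.single 0 1 : EuclideanSpace ℝ (Fin n)) = 0 := h3 _
  simp at h4

/-- The conformal factor does not vanish where the rank of `Ω² g` is locally constant, as the rank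
is `0` at the zeros of `Ω` only. -/
lemma conformal_factor_ne_zero_of_rankAt [NeZero n] (hg : ∀ p, NondegenerateAt g p)
    (hdense : Dense {p : M | Ω p ≠ 0}) {p : M}
    (hr : ∀ᶠ q in 𝓝 p, rankAt (conformalRescaling Ω g) q = rankAt (conformalRescaling Ω g) p) :
    Ω p ≠ 0 := by
  intro h0
  obtain ⟨q, hq, hq'⟩ := ((mem_closure_iff_frequently.1 (hdense p)).and_eventually hr).exists
  rw [rankAt_conformalRescaling_of_eq_zero h0] at hq'
  exact ((hg q).rescale hq).rankAt_ne_zero hq'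

variable [IsManifold (𝓡 n) ∞ M]

lemma exists_rescaledKoszul_eq_flat (hg : IsSingularMetric g) (hnd : ∀ p, NondegenerateAt g p)
    (hΩ : ContMDiff (𝓡 n) 𝓘(ℝ, ℝ) ∞ Ω) {X Y : ∀ p : M, TangentSpace (𝓡 n) p} {p : M}
    (hX : ContMDiffAt (𝓡 n) (𝓡 n).tangent ∞ (fun p => (X p : TangentBundle (𝓡 n) M)) p)
    (hY : ContMDiffAt (𝓡 n) (𝓡 n).tangent ∞ (fun p => (Y p : TangentBundle (𝓡 n) M)) p) :
    ∃ v : TangentSpace (𝓡 n) p, ∀ Z : ∀ p : M, TangentSpace (𝓡 n) p,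
      ContMDiffAt (𝓡 n) (𝓡 n).tangent ∞ (fun p => (Z p : TangentBundle (𝓡 n) M)) p →
        g p v (Z p) = rescaledKoszul g Ω X Y Z p := by
  obtain ⟨e, he, x, hx, rfl⟩ : ∃ e ∈ IsManifold.maximalAtlas (𝓡 n) ∞ M, ∃ x ∈ e.target,
      e.symm x = p := ⟨_, IsManifold.chart_mem_maximalAtlas p, _, mem_chart_target _ p,
        (chartAt _ p).left_inv (mem_chart_source _ p)⟩
  obtain ⟨v, hv⟩ := exists_eq_of_nondegenerate
    ((ContinuousLinearMap.coeLM ℝ).comp (localMetric g e x).toLinearMap)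
    (localMetric_nondegenerate he hx (hnd _))
    (localRescaledKoszulLin (localMetric g e) (Ω ∘ e.symm) (localField e X) (localField e Y) x)
  refine ⟨chartSymmDeriv e x v, fun Z hZ => ?_⟩
  rw [rescaledKoszul_symm hg hΩ he hx hX hY hZ, ← hv, ← chartSymmDeriv_localField he hx Z]
  rfl

/-- If `v` and `w` represent `θ(X,Y,_)` and `θ(Z,T,_)`, then `g(v,w)` is the contraction of these
one-forms, which is computed in a chart by a smooth expression. -/
lemma metric_apply_eq_metricTrace {e : OpenPartialHomeomorph M (EuclideanSpace ℝ (Fin n))}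
    {x : EuclideanSpace ℝ (Fin n)} (hg : IsSingularMetric g) (hnd : ∀ p, NondegenerateAt g p)
    (hΩ : ContMDiff (𝓡 n) 𝓘(ℝ, ℝ) ∞ Ω)
    (he : e ∈ IsManifold.maximalAtlas (𝓡 n) ∞ M) (hx : x ∈ e.target)
    {X Y Z T : ∀ p : M, TangentSpace (𝓡 n) p}
    (hX : ContMDiffAt (𝓡 n) (𝓡 n).tangent ∞ (fun p => (X p : TangentBundle (𝓡 n) M)) (e.symm x))
    (hY : ContMDiffAt (𝓡 n) (𝓡 n).tangent ∞ (fun p => (Y p : TangentBundle (𝓡 n) M)) (e.symm x))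
    (hZ : ContMDiffAt (𝓡 n) (𝓡 n).tangent ∞ (fun p => (Z p : TangentBundle (𝓡 n) M)) (e.symm x))
    (hT : ContMDiffAt (𝓡 n) (𝓡 n).tangent ∞ (fun p => (T p : TangentBundle (𝓡 n) M)) (e.symm x))
    {v w : TangentSpace (𝓡 n) (e.symm x)}
    (hv : ∀ W : ∀ p : M, TangentSpace (𝓡 n) p,
      ContMDiffAt (𝓡 n) (𝓡 n).tangent ∞ (fun p => (W p : TangentBundle (𝓡 n) M)) (e.symm x) →
        g (e.symm x) v (W (e.symm x)) = rescaledKoszul g Ω X Y W (e.symm x))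
    (hw : ∀ W : ∀ p : M, TangentSpace (𝓡 n) p,
      ContMDiffAt (𝓡 n) (𝓡 n).tangent ∞ (fun p => (W p : TangentBundle (𝓡 n) M)) (e.symm x) →
        g (e.symm x) w (W (e.symm x)) = rescaledKoszul g Ω Z T W (e.symm x)) :
    g (e.symm x) v w = metricTrace (localMetric g e x) fun s t =>
      localRescaledKoszul (localMetric g e) (Ω ∘ e.symm) (localField e X) (localField e Y) x s *
      localRescaledKoszul (localMetric g e) (Ω ∘ e.symm) (localField e Z) (localField e T) x t := by
  have key : ∀ {X Y : ∀ p : M, TangentSpace (𝓡 n) p},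
    ContMDiffAt (𝓡 n) (𝓡 n).tangent ∞ (fun p => (X p : TangentBundle (𝓡 n) M)) (e.symm x) →
    ContMDiffAt (𝓡 n) (𝓡 n).tangent ∞ (fun p => (Y p : TangentBundle (𝓡 n) M)) (e.symm x) →
    ∀ {u : EuclideanSpace ℝ (Fin n)}, (∀ W : ∀ p : M, TangentSpace (𝓡 n) p,
      ContMDiffAt (𝓡 n) (𝓡 n).tangent ∞ (fun p => (W p : TangentBundle (𝓡 n) M)) (e.symm x) →
        g (e.symm x) (chartSymmDeriv e x u) (W (e.symm x)) =
          rescaledKoszul g Ω X Y W (e.symm x)) →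
      ∀ s, localRescaledKoszul (localMetric g e) (Ω ∘ e.symm) (localField e X) (localField e Y) x s
        = localMetric g e x u s := by
    intro X Y hX hY u hu s
    obtain ⟨U, W, hU, hxU, hW, hWs⟩ := exists_smoothVectorFieldOn (e.symm x) (chartSymmDeriv e x s)
    have hW' := hW.contMDiffAt (hU.mem_nhds hxU)
    have h := hu W hW'
    rw [rescaledKoszul_symm hg hΩ he hx hX hY hW', (localField_eq_iff he hx W s).2 hWs, hWs] at h
    exact h.symm
  obtain ⟨v, rfl⟩ := (isInvertible_chartSymmDeriv he hx).surjective v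
  obtain ⟨w, rfl⟩ := (isInvertible_chartSymmDeriv he hx).surjective w
  simp only [key hX hY hv, key hZ hT hw]
  have h := metricTrace_flat_left (localMetric_nondegenerate he hx (hnd _)) v
    (localMetric g e x w).toLinearMap
  refine Eq.trans ?_ h.symm
  exact hg.symm _ _ _

/-- A conformal rescaling of a non-degenerate metric is semi-regular: the one-form `K(X,Y,_)` of
`Ω² g` is `Ω θ(X,Y,_)`, so the factor `Ω⁻²` of the reciprocal metric cancels in the contractions. -/
theorem isSemiRegular_conformalRescaling [NeZero n] (hg : IsSingularMetric g)
    (hnd : ∀ p, NondegenerateAt g p) (hΩ : ContMDiff (𝓡 n) 𝓘(ℝ, ℝ) ∞ Ω)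
    (hdense : Dense {p : M | Ω p ≠ 0}) : IsSemiRegular (conformalRescaling Ω g) where
  isSingularMetric := hg.rescale hΩ
  koszul_mem_flat U X Y hU hX hY p hp := by
    have hX' := hX.contMDiffAt (hU.mem_nhds hp)
    have hY' := hY.contMDiffAt (hU.mem_nhds hp)
    obtain ⟨v, hv⟩ := exists_rescaledKoszul_eq_flat hg hnd hΩ hX' hY'
    refine ⟨(Ω p)⁻¹ • v, fun U' Z hU' hp' hZ => ?_⟩
    have hZ' := hZ.contMDiffAt (hU'.mem_nhds hp')
    rw [koszul_conformalRescaling hg hΩ hX' hY' hZ', ← hv Z hZ', conformalRescaling_apply,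
      map_smul, smul_apply, smul_eq_mul, ← mul_assoc]
    -- the junk value `0⁻¹ = 0` is harmless at the zeros of `Ω`, where both sides vanish
    by_cases h0 : Ω p = 0
    · simp [h0]
    · field_simp
  contraction_smooth U X Y Z T hU hX hY hZ hT := by
    have hV : ∀ p, p ∈ U → ∃ v : TangentSpace (𝓡 n) p, ∀ W : ∀ p : M, TangentSpace (𝓡 n) p,
        ContMDiffAt (𝓡 n) (𝓡 n).tangent ∞ (fun p => (W p : TangentBundle (𝓡 n) M)) p →
          g p v (W p) = rescaledKoszul g Ω X Y W p := fun p hp =>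
      exists_rescaledKoszul_eq_flat hg hnd hΩ (hX.contMDiffAt (hU.mem_nhds hp))
        (hY.contMDiffAt (hU.mem_nhds hp))
    have hV' : ∀ p, p ∈ U → ∃ v : TangentSpace (𝓡 n) p, ∀ W : ∀ p : M, TangentSpace (𝓡 n) p,
        ContMDiffAt (𝓡 n) (𝓡 n).tangent ∞ (fun p => (W p : TangentBundle (𝓡 n) M)) p →
          g p v (W p) = rescaledKoszul g Ω Z T W p := fun p hp =>
      exists_rescaledKoszul_eq_flat hg hnd hΩ (hZ.contMDiffAt (hU.mem_nhds hp))
        (hT.contMDiffAt (hU.mem_nhds hp))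
    choose! v hv using hV
    choose! w hw using hV'
    refine ⟨fun p => g p (v p) (w p), fun p hp => ContMDiffAt.contMDiffWithinAt ?_, ?_⟩
    · set e := chartAt (EuclideanSpace ℝ (Fin n)) p with e_def
      have he : e ∈ IsManifold.maximalAtlas (𝓡 n) ∞ M := IsManifold.chart_mem_maximalAtlas p
      have hpe : p ∈ e.source := mem_chart_source _ p
      have hx : e p ∈ e.target := e.map_source hpe
      have hsm : ∀ {X : ∀ p : M, TangentSpace (𝓡 n) p}, SmoothVectorFieldOn X U →
          ContDiffAt ℝ ∞ (localField e X) (e p) := fun hX => by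
        refine contDiffAt_localField he hx ?_
        rw [e.left_inv hpe]
        exact hX.contMDiffAt (hU.mem_nhds hp)
      have hG := contDiffAt_localMetric hg he hx
      have hσ : ContDiffAt ℝ ∞ (Ω ∘ e.symm) (e p) := contDiffAt_comp_symm he hx hΩ.contMDiffAt
      have hH := contDiffAt_metricTrace hG (localMetric_nondegenerate he hx (hnd _))
        (f := fun y s t =>
          localRescaledKoszul (localMetric g e) (Ω ∘ e.symm) (localField e X) (localField e Y) y s *
          localRescaledKoszul (localMetric g e) (Ω ∘ e.symm) (localField e Z) (localField e T) y t)
        fun s t => (contDiffAt_localRescaledKoszul hG hσ (hsm hX) (hsm hY) s).mul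
          (contDiffAt_localRescaledKoszul hG hσ (hsm hZ) (hsm hT) t)
      refine (hH.contMDiffAt.comp p (contMDiffAt_of_mem_maximalAtlas he
        hpe)).congr_of_eventuallyEq ?_
      filter_upwards [e.open_source.mem_nhds hpe, hU.mem_nhds hp] with q hq hqU
      obtain ⟨y, hy, rfl⟩ : ∃ y ∈ e.target, e.symm y = q := ⟨e q, e.map_source hq, e.left_inv hq⟩
      have hq' := hU.mem_nhds hqU
      rw [Function.comp_apply, e.right_inv hy]
      exact metric_apply_eq_metricTrace hg hnd hΩ he hy (hX.contMDiffAt hq') (hY.contMDiffAt hq')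
        (hZ.contMDiffAt hq') (hT.contMDiffAt hq') (hv _ hqU) (hw _ hqU)
    · intro p hp hr v' w' hv' hw'
      have h0 : Ω p ≠ 0 := conformal_factor_ne_zero_of_rankAt hnd hdense hr
      have key : ∀ {X Y : ∀ p : M, TangentSpace (𝓡 n) p}, SmoothVectorFieldOn X U →
          SmoothVectorFieldOn Y U → ∀ {v v' : TangentSpace (𝓡 n) p},
          (∀ W : ∀ p : M, TangentSpace (𝓡 n) p,
            ContMDiffAt (𝓡 n) (𝓡 n).tangent ∞ (fun p => (W p : TangentBundle (𝓡 n) M)) p →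
              g p v (W p) = rescaledKoszul g Ω X Y W p) →
          KoszulEqFlat (conformalRescaling Ω g) X Y p v' → v = Ω p • v' := by
        intro X Y hX hY v v' hv hv'
        refine sub_eq_zero.1 (hnd p _ fun u => ?_)
        obtain ⟨U', W, hU', hpU', hW, rfl⟩ := exists_smoothVectorFieldOn p u
        have h := hv' U' W hU' hpU' hW
        have hW' := hW.contMDiffAt (hU'.mem_nhds hpU')
        rw [koszul_conformalRescaling hg hΩ (hX.contMDiffAt (hU.mem_nhds hp))
          (hY.contMDiffAt (hU.mem_nhds hp)) hW', ← hv W hW', conformalRescaling_apply] at h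
        rw [map_sub, sub_apply, map_smul, smul_apply, smul_eq_mul, sub_eq_zero]
        exact mul_left_cancel₀ h0 (by rw [h]; ring)
      change g p (v p) (w p) = _
      rw [key hX hY (hv p hp) hv', key hZ hT (hw p hp) hw', conformalRescaling_apply]
      simp only [map_smul, smul_apply, smul_eq_mul]
      ring

end

/-! ### The rescaled Ricci tensor -/

section

variable {n : ℕ} {M : Type*} [TopologicalSpace M] [ChartedSpace (EuclideanSpace ℝ (Fin n)) M]

section Flat

/-- The bilinear form with the components of `rescaledRicci` in the standard basis. It is bilinear
by
construction also where `σ` vanishes. -/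
def rescaledRicciBilin
    (G : EuclideanSpace ℝ (Fin n) → EuclideanSpace ℝ (Fin n) →L[ℝ] EuclideanSpace ℝ (Fin n) →L[ℝ] ℝ)
    (σ : EuclideanSpace ℝ (Fin n) → ℝ) (x : EuclideanSpace ℝ (Fin n)) :
    EuclideanSpace ℝ (Fin n) →ₗ[ℝ] EuclideanSpace ℝ (Fin n) →ₗ[ℝ] ℝ :=
  LinearMap.mk₂ ℝ (fun u v => ∑ a, ∑ b, u a * v b *
      rescaledRicci G σ x (EuclideanSpace.single a 1) (EuclideanSpace.single b 1))
    (fun u u' v => by simp [add_mul, Finset.sum_add_distrib])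
    (fun c u v => by simp [Finset.mul_sum, mul_assoc])
    (fun u v v' => by simp [add_mul, mul_add, Finset.sum_add_distrib])
    (fun c u v => by simp [Finset.mul_sum, mul_assoc, mul_left_comm])

variable {G : EuclideanSpace ℝ (Fin n) →
    EuclideanSpace ℝ (Fin n) →L[ℝ] EuclideanSpace ℝ (Fin n) →L[ℝ] ℝ}
  {σ : EuclideanSpace ℝ (Fin n) → ℝ} {x : EuclideanSpace ℝ (Fin n)}

lemma ricciForm_eq_sum (hG : ContDiffAt ℝ 2 G x) (u v : EuclideanSpace ℝ (Fin n)) :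
    ricciForm G x u v = ∑ a, ∑ b, u a * v b *
      ricciForm G x (EuclideanSpace.single a 1) (EuclideanSpace.single b 1) :=
  bilin_eq_sum (bilinOfLinear (ricciForm G x) (ricciForm_linear_left hG)
    (ricciForm_linear_right hG)) u v

lemma rescaledRicciBilin_eq (hG : ContDiffAt ℝ ∞ G x) (hσ : ContDiffAt ℝ ∞ σ x)
    (hs : ∀ u v, G x u v = G x v u) (h0 : σ x ≠ 0) (u v : EuclideanSpace ℝ (Fin n)) :
    rescaledRicciBilin G σ x u v = σ x ^ 2 * ricciForm (fun y => σ y ^ 2 • G y) x u v := by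
  have hσG : ContDiffAt ℝ ∞ (fun y => σ y ^ 2 • G y) x := (hσ.pow 2).smul hG
  rw [ricciForm_eq_sum (hσG.of_le ENat.LEInfty.out)]
  simp only [rescaledRicciBilin, LinearMap.mk₂_apply, Finset.mul_sum]
  refine Finset.sum_congr rfl fun a _ => Finset.sum_congr rfl fun b _ => ?_
  rw [rescaledRicci_eq (hG.differentiableAt (by simp)) (hσ.differentiableAt (by simp)) hs h0]
  ring

lemma contDiffAt_rescaledRicciBilin (hG : ContDiffAt ℝ ∞ G x) (hσ : ContDiffAt ℝ ∞ σ x)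
    (hnd : ∀ v, (∀ w, G x v w = 0) → v = 0) {u v : EuclideanSpace ℝ (Fin n) → EuclideanSpace ℝ
    (Fin n)}
    (hu : ContDiffAt ℝ ∞ u x) (hv : ContDiffAt ℝ ∞ v x) :
    ContDiffAt ℝ ∞ (fun y => rescaledRicciBilin G σ y (u y) (v y)) x := by
  have hc : ∀ {u : EuclideanSpace ℝ (Fin n) → EuclideanSpace ℝ (Fin n)}, ContDiffAt ℝ ∞ u x →
      ∀ a, ContDiffAt ℝ ∞ (fun y => u y a) x := fun hu a => contDiffAt_euclidean.1 hu a
  simp only [rescaledRicciBilin, LinearMap.mk₂_apply]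
  exact ContDiffAt.sum fun a _ => ContDiffAt.sum fun b _ =>
    ((hc hu a).mul (hc hv b)).mul (contDiffAt_rescaledRicci hG hσ hnd _ _)

/-- The Kulkarni–Nomizu product of two bilinear forms. -/
def kulkarniNomizuForm {V : Type*} [AddCommGroup V] [Module ℝ V] (h k : V →ₗ[ℝ] V →ₗ[ℝ] ℝ) :
    V →ₗ[ℝ] V →ₗ[ℝ] V →ₗ[ℝ] V →ₗ[ℝ] ℝ :=
  LinearMap.mk₂ ℝ (fun a b => LinearMap.mk₂ ℝ
      (fun c d => h a c * k b d - h a d * k b c + h b d * k a c - h b c * k a d)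
      (fun c c' d => by simp; ring) (fun r c d => by simp; ring)
      (fun c d d' => by simp; ring) (fun r c d => by simp; ring))
    (fun a a' b => by ext; simp; ring) (fun r a b => by ext; simp; ring)
    (fun a b b' => by ext; simp; ring) (fun r a b => by ext; simp; ring)

lemma kulkarniNomizuForm_apply {V : Type*} [AddCommGroup V] [Module ℝ V]
    (h k : V →ₗ[ℝ] V →ₗ[ℝ] ℝ) (a b c d : V) : kulkarniNomizuForm h k a b c d =
      h a c * k b d - h a d * k b c + h b d * k a c - h b c * k a d := rfl

end Flat

variable {e e' : OpenPartialHomeomorph M (EuclideanSpace ℝ (Fin n))}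
  {x : EuclideanSpace ℝ (Fin n)} {g : BilinField n M} {Ω : M → ℝ}

/-- The bilinear form `rescaledRicciBilin` of the representatives of `g` and `Ω` in the chart `e`,
at a point of the domain of `e`. -/
def chartRicci (g : BilinField n M) (Ω : M → ℝ)
    (e : OpenPartialHomeomorph M (EuclideanSpace ℝ (Fin n))) (p : M) :
    TangentSpace (𝓡 n) p →ₗ[ℝ] TangentSpace (𝓡 n) p →ₗ[ℝ] ℝ :=
  (rescaledRicciBilin (localMetric g e) (Ω ∘ e.symm) (e p)).compl₁₂
    (mfderiv (𝓡 n) (𝓡 n) e p).toLinearMap (mfderiv (𝓡 n) (𝓡 n) e p).toLinearMap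

lemma chartRicci_apply (g : BilinField n M) (Ω : M → ℝ)
    (e : OpenPartialHomeomorph M (EuclideanSpace ℝ (Fin n))) (p : M) (v w : TangentSpace (𝓡 n) p) :
    chartRicci g Ω e p v w = rescaledRicciBilin (localMetric g e) (Ω ∘ e.symm) (e p)
      (mfderiv (𝓡 n) (𝓡 n) e p v) (mfderiv (𝓡 n) (𝓡 n) e p w) := rfl

lemma chartRicci_symm (he : e ∈ IsManifold.maximalAtlas (𝓡 n) ∞ M) (hx : x ∈ e.target)
    (u v : EuclideanSpace ℝ (Fin n)) :
    chartRicci g Ω e (e.symm x) (chartSymmDeriv e x u) (chartSymmDeriv e x v) =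
      rescaledRicciBilin (localMetric g e) (Ω ∘ e.symm) x u v := by
  refine (chartRicci_apply g Ω e _ _ _).trans ?_
  have h : rescaledRicciBilin (localMetric g e) (Ω ∘ e.symm) (e (e.symm x)) =
    rescaledRicciBilin (localMetric g e) (Ω ∘ e.symm) x := congrArg _ (e.right_inv hx)
  have h1 := mfderiv_chartSymmDeriv he hx
  refine (congrArg (fun B : EuclideanSpace ℝ (Fin n) →ₗ[ℝ] EuclideanSpace ℝ (Fin n) →ₗ[ℝ] ℝ
    => B _ _) h).trans ?_
  exact congrArg₂ (fun a b => rescaledRicciBilin (localMetric g e) (Ω ∘ e.symm) x a b) (h1 u) (h1 v)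

variable [IsManifold (𝓡 n) ∞ M]

section Invariance

variable (hg : IsSingularMetric g) (hnd : ∀ p, NondegenerateAt g p)
  (hΩ : ContMDiff (𝓡 n) 𝓘(ℝ, ℝ) ∞ Ω)
include hg hnd hΩ

lemma rescaledRicciBilin_transition_of_ne_zero
    (he : e ∈ IsManifold.maximalAtlas (𝓡 n) ∞ M) (he' : e' ∈ IsManifold.maximalAtlas (𝓡 n) ∞ M)
    (hx : x ∈ e.target) (hx' : e.symm x ∈ e'.source) (h0 : Ω (e.symm x) ≠ 0)
    (u v : EuclideanSpace ℝ (Fin n)) :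
    rescaledRicciBilin (localMetric g e) (Ω ∘ e.symm) x u v =
      rescaledRicciBilin (localMetric g e') (Ω ∘ e'.symm) ((e' ∘ e.symm) x)
        (fderiv ℝ (e' ∘ e.symm) x u) (fderiv ℝ (e' ∘ e.symm) x v) := by
  have hy : (e' ∘ e.symm) x ∈ e'.target := e'.map_source hx'
  have hgc := hg.rescale hΩ
  have hσ : (Ω ∘ e'.symm) ((e' ∘ e.symm) x) = Ω (e.symm x) := by
    simp only [Function.comp_apply, e'.left_inv hx']
  have hφ := contDiffAt_transition he he' hx hx'
  obtain ⟨J, hJ⟩ := exists_transition_equiv he he' hx hx'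
  rw [rescaledRicciBilin_eq (contDiffAt_localMetric hg he hx)
      (contDiffAt_comp_symm he hx hΩ.contMDiffAt) (localMetric_comm hg) h0,
    rescaledRicciBilin_eq (contDiffAt_localMetric hg he' hy)
      (contDiffAt_comp_symm he' hy hΩ.contMDiffAt) (localMetric_comm hg) (by rwa [hσ]), hσ,
    ← localMetric_conformalRescaling, ← localMetric_conformalRescaling,
    ricciForm_pullback ((contDiffAt_localMetric hgc he hx).of_le ENat.LEInfty.out)
      ((contDiffAt_localMetric hgc he' hy).of_le ENat.LEInfty.out)
      (hφ.of_le ENat.LEInfty.out) (.of_forall fun _ => localMetric_comm hgc)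
      (eventually_localMetric_transition he he' hx hx' _)
      (localMetric_nondegenerate he' hy ((hnd _).rescale (by rw [Function.comp_apply] at hσ; rwa
      [hσ])))
      J hJ, hJ, hJ]
  rfl

variable (hdense : Dense {p : M | Ω p ≠ 0})
include hdense

/-- The bilinear form `rescaledRicciBilin` transforms as a tensor also at the zeros of `Ω`, by
continuity. -/
lemma rescaledRicciBilin_transition
    (he : e ∈ IsManifold.maximalAtlas (𝓡 n) ∞ M) (he' : e' ∈ IsManifold.maximalAtlas (𝓡 n) ∞ M)
    (hx : x ∈ e.target) (hx' : e.symm x ∈ e'.source) (u v : EuclideanSpace ℝ (Fin n)) :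
    rescaledRicciBilin (localMetric g e) (Ω ∘ e.symm) x u v =
      rescaledRicciBilin (localMetric g e') (Ω ∘ e'.symm) ((e' ∘ e.symm) x)
        (fderiv ℝ (e' ∘ e.symm) x u) (fderiv ℝ (e' ∘ e.symm) x v) := by
  have hy : (e' ∘ e.symm) x ∈ e'.target := e'.map_source hx'
  have hφ := contDiffAt_transition he he' hx hx'
  have h1 := contDiffAt_rescaledRicciBilin (contDiffAt_localMetric hg he hx)
    (contDiffAt_comp_symm he hx hΩ.contMDiffAt) (localMetric_nondegenerate he hx (hnd _))
    (contDiffAt_const (c := u)) (contDiffAt_const (c := v))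
  have h2 : ∀ u v : EuclideanSpace ℝ (Fin n), ContinuousAt (fun y => rescaledRicciBilin
      (localMetric g e') (Ω ∘ e'.symm) ((e' ∘ e.symm) y) u v) x := fun u v =>
    ContinuousAt.comp (f := e' ∘ e.symm) (contDiffAt_rescaledRicciBilin
      (contDiffAt_localMetric hg he' hy)
      (contDiffAt_comp_symm he' hy hΩ.contMDiffAt) (localMetric_nondegenerate he' hy (hnd _))
      contDiffAt_const contDiffAt_const).continuousAt hφ.continuousAt
  have h3 : ∀ u a, ContinuousAt (fun y => fderiv ℝ (e' ∘ e.symm) y u a) x := fun u a =>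
    (contDiffAt_euclidean.1 (contDiffAt_fderiv_apply hφ u) a).continuousAt
  have h4 : ContinuousAt (fun y => rescaledRicciBilin (localMetric g e') (Ω ∘ e'.symm)
      ((e' ∘ e.symm) y) (fderiv ℝ (e' ∘ e.symm) y u) (fderiv ℝ (e' ∘ e.symm) y v)) x := by
    simp only [fun y => bilin_eq_sum (rescaledRicciBilin (localMetric g e') (Ω ∘ e'.symm)
      ((e' ∘ e.symm) y)) (fderiv ℝ (e' ∘ e.symm) y u) (fderiv ℝ (e' ∘ e.symm) y v)]
    exact tendsto_finsetSum _ fun a _ => tendsto_finsetSum _ fun b _ =>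
      ((h3 u a).mul (h3 v b)).mul (h2 _ _)
  refine tendsto_nhds_unique_of_frequently_eq h1.continuousAt h4 ?_
  have hf : ∃ᶠ y in 𝓝 x, Ω (e.symm y) ≠ 0 := by
    have := mem_closure_iff_frequently.1 (hdense (e.symm x))
    rw [← e.symm.map_nhds_eq hx] at this
    exact this
  refine (hf.and_eventually ((e.open_target.eventually_mem hx).and
    ((e.continuousAt_symm hx).eventually (e'.open_source.eventually_mem hx')))).mono ?_
  rintro y ⟨hy0, hy1, hy2⟩
  exact rescaledRicciBilin_transition_of_ne_zero hg hnd hΩ he he' hy1 hy2 hy0 u v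

/-- `chartRicci` does not depend on the chart. -/
lemma chartRicci_eq (he : e ∈ IsManifold.maximalAtlas (𝓡 n) ∞ M)
    (he' : e' ∈ IsManifold.maximalAtlas (𝓡 n) ∞ M) {p : M} (hp : p ∈ e.source) (hp' :
    p ∈ e'.source) :
    chartRicci g Ω e p = chartRicci g Ω e' p := by
  obtain ⟨x, hx, rfl⟩ : ∃ x ∈ e.target, e.symm x = p := ⟨e p, e.map_source hp, e.left_inv hp⟩
  ext v w
  obtain ⟨v, rfl⟩ := (isInvertible_chartSymmDeriv he hx).surjective v
  obtain ⟨w, rfl⟩ := (isInvertible_chartSymmDeriv he hx).surjective w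
  rw [chartRicci_symm he hx, rescaledRicciBilin_transition hg hnd hΩ hdense he he' hx hp',
    fderiv_transition he he' hx hp', fderiv_transition he he' hx hp']
  rfl

end Invariance

end

/-! ### Signature and quasi-regularity of conformal rescalings -/

section

variable {n : ℕ} {M : Type*} [TopologicalSpace M] [ChartedSpace (EuclideanSpace ℝ (Fin n)) M]
variable {e e' : OpenPartialHomeomorph M (EuclideanSpace ℝ (Fin n))}
  {x : EuclideanSpace ℝ (Fin n)} {g : BilinField n M} {Ω : M → ℝ}

section Signature

open QuadraticForm in
/-- Multiplication by a square, possibly zero, does not increase the index of positivity. -/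
lemma sigPos_le_of_sq_mul {V : Type*} [AddCommGroup V] [Module ℝ V] [FiniteDimensional ℝ V]
    {Q Q' : QuadraticForm ℝ V} {c : ℝ} (h : ∀ v, Q' v = c ^ 2 * Q v) : sigPos Q' ≤ sigPos Q := by
  obtain ⟨W, hW, hpos⟩ := exists_finrank_eq_sigPos_and_posDef Q'
  rw [← hW]
  refine le_sigPos_of_posDef Q fun w hw => ?_
  have h1 : 0 < c ^ 2 * Q w := by rw [← h]; exact hpos w hw
  exact pos_of_mul_pos_right h1 (sq_nonneg c)

lemma HasSpacetimeSignature.rescale (h : HasSpacetimeSignature g) :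
    HasSpacetimeSignature (conformalRescaling Ω g) := by
  intro p
  have : FiniteDimensional ℝ (TangentSpace (𝓡 n) p) :=
    inferInstanceAs (FiniteDimensional ℝ (EuclideanSpace ℝ (Fin n)))
  have hq : ∀ v, quadForm (conformalRescaling Ω g) p v = Ω p ^ 2 * quadForm g p v := fun v => rfl
  refine ⟨(sigPos_le_of_sq_mul hq).trans (h p).1, ?_⟩
  exact (sigPos_le_of_sq_mul (Q := -quadForm g p) (Q' := -quadForm (conformalRescaling Ω g) p)
    (c := Ω p) fun v => by simp [hq]).trans (h p).2

end Signature

/-- The trace of `chartRicci`, computed in the chart `e`. -/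
def chartScalar (g : BilinField n M) (Ω : M → ℝ)
    (e : OpenPartialHomeomorph M (EuclideanSpace ℝ (Fin n))) (p : M) : ℝ :=
  metricTrace (localMetric g e (e p))
    fun s t => rescaledRicciBilin (localMetric g e) (Ω ∘ e.symm) (e p) s t

lemma metricMatrix_conformalRescaling (g : BilinField n M) (Ω : M → ℝ)
    (e : OpenPartialHomeomorph M (EuclideanSpace ℝ (Fin n))) (p : M) (a b : Fin n) :
    metricMatrix (conformalRescaling Ω g) e p a b = Ω p ^ 2 * metricMatrix g e p a b := rfl

variable [IsManifold (𝓡 n) ∞ M]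

section Fields

variable (hg : IsSingularMetric g) (hnd : ∀ p, NondegenerateAt g p)
  (hΩ : ContMDiff (𝓡 n) 𝓘(ℝ, ℝ) ∞ Ω)
include hg hΩ

lemma chartRicci_coordField (he : e ∈ IsManifold.maximalAtlas (𝓡 n) ∞ M) {p : M}
    (hp : p ∈ e.source) (h0 : Ω p ≠ 0) (a b : Fin n) :
    chartRicci g Ω e p (coordField e a p) (coordField e b p) =
      Ω p ^ 2 * ricci (conformalRescaling Ω g) e p a b := by
  obtain ⟨x, hx, rfl⟩ : ∃ x ∈ e.target, e.symm x = p := ⟨e p, e.map_source hp, e.left_inv hp⟩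
  rw [coordField_symm he hx, coordField_symm he hx, chartRicci_symm he hx,
    ricci_symm (hg.rescale hΩ) he hx, rescaledRicciBilin_eq (contDiffAt_localMetric hg he hx)
      (contDiffAt_comp_symm he hx hΩ.contMDiffAt) (localMetric_comm hg) h0]
  rfl

lemma chartScalar_eq_scalarCurvature (he : e ∈ IsManifold.maximalAtlas (𝓡 n) ∞ M) {p : M}
    (hp : p ∈ e.source) (h0 : Ω p ≠ 0) :
    chartScalar g Ω e p = Ω p ^ 4 * scalarCurvature (conformalRescaling Ω g) e p := by
  obtain ⟨x, hx, rfl⟩ : ∃ x ∈ e.target, e.symm x = p := ⟨e p, e.map_source hp, e.left_inv hp⟩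
  have h1 := metricTrace_smul_metric (localMetric g e x) (pow_ne_zero 2 h0)
    (ricciForm (localMetric (conformalRescaling Ω g) e) x)
  have h2 : chartScalar g Ω e (e.symm x) = Ω (e.symm x) ^ 2 *
      metricTrace (localMetric g e x) (ricciForm (localMetric (conformalRescaling Ω g) e) x) := by
    rw [chartScalar, e.right_inv hx, ← metricTrace_const_mul]
    refine metricTrace_congr _ fun s t => ?_
    rw [rescaledRicciBilin_eq (contDiffAt_localMetric hg he hx)
      (contDiffAt_comp_symm he hx hΩ.contMDiffAt) (localMetric_comm hg) h0,
      ← localMetric_conformalRescaling]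
    rfl
  rw [scalarCurvature_symm (hg.rescale hΩ) he hx, h2]
  refine Eq.trans ?_ (congrArg (fun c => Ω (e.symm x) ^ 4 * c) h1.symm)
  field_simp

include hnd

lemma contMDiffAt_chartScalar (he : e ∈ IsManifold.maximalAtlas (𝓡 n) ∞ M) {p : M}
    (hp : p ∈ e.source) : ContMDiffAt (𝓡 n) 𝓘(ℝ, ℝ) ∞ (chartScalar g Ω e) p := by
  have hx := e.map_source hp
  have hG := contDiffAt_localMetric hg he hx
  have hσ : ContDiffAt ℝ ∞ (Ω ∘ e.symm) (e p) := contDiffAt_comp_symm he hx hΩ.contMDiffAt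
  have hn := localMetric_nondegenerate he hx (hnd _)
  have h := contDiffAt_metricTrace hG hn
    (f := fun y s t => rescaledRicciBilin (localMetric g e) (Ω ∘ e.symm) y s t)
    fun s t => contDiffAt_rescaledRicciBilin hG hσ hn contDiffAt_const contDiffAt_const
  exact h.contMDiffAt.comp p (contMDiffAt_of_mem_maximalAtlas he hp)

lemma contMDiffAt_chartRicci (he : e ∈ IsManifold.maximalAtlas (𝓡 n) ∞ M) {p : M}
    (hp : p ∈ e.source) {X Y : ∀ p : M, TangentSpace (𝓡 n) p}
    (hX : ContMDiffAt (𝓡 n) (𝓡 n).tangent ∞ (fun p => (X p : TangentBundle (𝓡 n) M)) p)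
    (hY : ContMDiffAt (𝓡 n) (𝓡 n).tangent ∞ (fun p => (Y p : TangentBundle (𝓡 n) M)) p) :
    ContMDiffAt (𝓡 n) 𝓘(ℝ, ℝ) ∞ (fun q => chartRicci g Ω e q (X q) (Y q)) p := by
  obtain ⟨x, hx, rfl⟩ : ∃ x ∈ e.target, e.symm x = p := ⟨e p, e.map_source hp, e.left_inv hp⟩
  have h := contDiffAt_rescaledRicciBilin (contDiffAt_localMetric hg he hx)
    (contDiffAt_comp_symm he hx hΩ.contMDiffAt) (localMetric_nondegenerate he hx (hnd _))
    (contDiffAt_localField he hx hX) (contDiffAt_localField he hx hY)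
  have h' := h.contMDiffAt
  rw [← e.right_inv hx] at h'
  refine (h'.comp (e.symm x) (contMDiffAt_of_mem_maximalAtlas he hp)).congr_of_eventuallyEq ?_
  filter_upwards [e.open_source.mem_nhds hp] with q hq
  obtain ⟨y, hy, rfl⟩ : ∃ y ∈ e.target, e.symm y = q := ⟨e q, e.map_source hq, e.left_inv hq⟩
  rw [Function.comp_apply, e.right_inv hy, ← chartSymmDeriv_localField he hy X,
    ← chartSymmDeriv_localField he hy Y]
  exact chartRicci_symm he hy _ _

variable (hdense : Dense {p : M | Ω p ≠ 0})
include hdense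

lemma chartScalar_eq (he : e ∈ IsManifold.maximalAtlas (𝓡 n) ∞ M)
    (he' : e' ∈ IsManifold.maximalAtlas (𝓡 n) ∞ M) {p : M} (hp : p ∈ e.source) (hp' :
    p ∈ e'.source) :
    chartScalar g Ω e p = chartScalar g Ω e' p := by
  obtain ⟨x, hx, rfl⟩ : ∃ x ∈ e.target, e.symm x = p := ⟨e p, e.map_source hp, e.left_inv hp⟩
  obtain ⟨J, hJ⟩ := exists_transition_equiv he he' hx hp'
  rw [chartScalar, chartScalar, e.right_inv hx]
  refine metricTrace_pullback (rescaledRicciBilin (localMetric g e') (Ω ∘ e'.symm) (e' (e.symm x)))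
    J (fun u v => ?_) fun u v => ?_
  · rw [hJ, hJ]; exact localMetric_transition he he' hx hp' g u v
  · rw [hJ, hJ]; exact rescaledRicciBilin_transition hg hnd hΩ hdense he he' hx hp' u v

/-- The Ricci tensor of `Ω² g`, multiplied by `Ω²`, extends to a smooth tensor field. -/
lemma exists_smooth_ricci : ∃ h : ∀ p : M, TangentSpace (𝓡 n) p →ₗ[ℝ] TangentSpace (𝓡 n) p →ₗ[ℝ] ℝ,
    (∀ (U : Set M) (X Y : ∀ p : M, TangentSpace (𝓡 n) p), IsOpen U → SmoothVectorFieldOn X U →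
      SmoothVectorFieldOn Y U → ContMDiffOn (𝓡 n) 𝓘(ℝ, ℝ) ∞ (fun p => h p (X p) (Y p)) U) ∧
    ∀ e ∈ IsManifold.maximalAtlas (𝓡 n) ∞ M, ∀ p ∈ e.source, Ω p ≠ 0 → ∀ a b,
      h p (coordField e a p) (coordField e b p) =
        Ω p ^ 2 * ricci (conformalRescaling Ω g) e p a b := by
  have hc : ∀ q : M, chartAt (EuclideanSpace ℝ (Fin n)) q ∈ IsManifold.maximalAtlas (𝓡 n) ∞ M :=
    fun q => IsManifold.chart_mem_maximalAtlas q
  refine ⟨fun p => chartRicci g Ω (chartAt _ p) p, fun U X Y hU hX hY p hp => ?_,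
    fun e he p hp h0 a b => ?_⟩
  · refine ((contMDiffAt_chartRicci hg hnd hΩ (hc p) (mem_chart_source _ p)
      (hX.contMDiffAt (hU.mem_nhds hp)) (hY.contMDiffAt (hU.mem_nhds hp))).congr_of_eventuallyEq
        ?_).contMDiffWithinAt
    filter_upwards [(chartAt (EuclideanSpace ℝ (Fin n)) p).open_source.mem_nhds
      (mem_chart_source _ p)] with q hq
    rw [chartRicci_eq hg hnd hΩ hdense (hc q) (hc p) (mem_chart_source _ q) hq]
  · change chartRicci g Ω (chartAt _ p) p _ _ = _
    rw [chartRicci_eq hg hnd hΩ hdense (hc p) he (mem_chart_source _ p) hp]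
    exact chartRicci_coordField hg hΩ he hp h0 a b

/-- The scalar curvature of `Ω² g`, multiplied by `Ω⁴`, extends to a smooth function. -/
lemma exists_smooth_scalarCurvature : ∃ ρ : M → ℝ, ContMDiff (𝓡 n) 𝓘(ℝ, ℝ) ∞ ρ ∧
    ∀ e ∈ IsManifold.maximalAtlas (𝓡 n) ∞ M, ∀ p ∈ e.source, Ω p ≠ 0 →
      ρ p = Ω p ^ 4 * scalarCurvature (conformalRescaling Ω g) e p := by
  have hc : ∀ q : M, chartAt (EuclideanSpace ℝ (Fin n)) q ∈ IsManifold.maximalAtlas (𝓡 n) ∞ M :=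
    fun q => IsManifold.chart_mem_maximalAtlas q
  refine ⟨fun p => chartScalar g Ω (chartAt _ p) p, fun p => ?_, fun e he p hp h0 => ?_⟩
  · refine (contMDiffAt_chartScalar hg hnd hΩ (hc p) (mem_chart_source _ p)).congr_of_eventuallyEq
      ?_
    filter_upwards [(chartAt (EuclideanSpace ℝ (Fin n)) p).open_source.mem_nhds
      (mem_chart_source _ p)] with q hq
    exact chartScalar_eq hg hnd hΩ hdense (hc q) (hc p) (mem_chart_source _ q) hq
  · change chartScalar g Ω (chartAt _ p) p = _
    rw [chartScalar_eq hg hnd hΩ hdense (hc p) he (mem_chart_source _ p) hp]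
    exact chartScalar_eq_scalarCurvature hg hΩ he hp h0

end Fields

/-- The Kulkarni–Nomizu product of a smooth field of bilinear forms with a metric is smooth. -/
lemma smooth_kulkarniNomizuForm (hg : IsSingularMetric g)
    {h : ∀ p : M, TangentSpace (𝓡 n) p →ₗ[ℝ] TangentSpace (𝓡 n) p →ₗ[ℝ] ℝ}
    (hh : ∀ (U : Set M) (X Y : ∀ p : M, TangentSpace (𝓡 n) p), IsOpen U → SmoothVectorFieldOn X U →
      SmoothVectorFieldOn Y U → ContMDiffOn (𝓡 n) 𝓘(ℝ, ℝ) ∞ (fun p => h p (X p) (Y p)) U) :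
    TensorField4.Smooth (fun p => kulkarniNomizuForm (h p)
      ((ContinuousLinearMap.coeLM ℝ).comp (g p).toLinearMap) : TensorField4 n M) := by
  intro U X Y Z T hU hX hY hZ hT
  have hg' : ∀ {X Y : ∀ p : M, TangentSpace (𝓡 n) p}, SmoothVectorFieldOn X U →
      SmoothVectorFieldOn Y U → ContMDiffOn (𝓡 n) 𝓘(ℝ, ℝ) ∞ (fun p => g p (X p) (Y p)) U :=
    fun hX hY p hp => (contMDiffAt_metric_apply hg (hX.contMDiffAt (hU.mem_nhds hp))
      (hY.contMDiffAt (hU.mem_nhds hp))).contMDiffWithinAt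
  exact ((((hh U X Z hU hX hZ).mul (hg' hY hT)).sub ((hh U X T hU hX hT).mul (hg' hY hZ))).add
    ((hh U Y T hU hY hT).mul (hg' hX hZ))).sub ((hh U Y Z hU hY hZ).mul (hg' hX hT))

/-- A conformal rescaling of a non-degenerate metric is quasi-regular: the scalar part and the
semi-traceless part are Kulkarni–Nomizu products of `g` with the extensions of `Ω⁴ R̃ g` and of
`Ω² S̃`, up to constant factors. -/
theorem isQuasiRegular_conformalRescaling [NeZero n] (hg : IsSingularMetric g)
    (hnd : ∀ p, NondegenerateAt g p) (hΩ : ContMDiff (𝓡 n) 𝓘(ℝ, ℝ) ∞ Ω)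
    (hdense : Dense {p : M | Ω p ≠ 0}) : IsQuasiRegular (conformalRescaling Ω g) := by
  obtain ⟨r, hr, hr'⟩ := exists_smooth_ricci hg hnd hΩ hdense
  obtain ⟨ρ, hρ, hρ'⟩ := exists_smooth_scalarCurvature hg hnd hΩ hdense
  have hg' : ∀ (U : Set M) (X Y : ∀ p : M, TangentSpace (𝓡 n) p), IsOpen U →
      SmoothVectorFieldOn X U → SmoothVectorFieldOn Y U →
        ContMDiffOn (𝓡 n) 𝓘(ℝ, ℝ) ∞ (fun p => g p (X p) (Y p)) U :=
    fun U X Y hU hX hY p hp => (contMDiffAt_metric_apply hg (hX.contMDiffAt (hU.mem_nhds hp))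
      (hY.contMDiffAt (hU.mem_nhds hp))).contMDiffWithinAt
  refine ⟨isSemiRegular_conformalRescaling hg hnd hΩ hdense,
    hdense.mono fun p hp => (hnd p).rescale hp, ?_, ?_⟩
  · refine ⟨fun p => kulkarniNomizuForm ((1 / (2 * (n : ℝ) * ((n : ℝ) - 1)) * ρ p) •
      (ContinuousLinearMap.coeLM ℝ).comp (g p).toLinearMap)
      ((ContinuousLinearMap.coeLM ℝ).comp (g p).toLinearMap),
      smooth_kulkarniNomizuForm hg fun U X Y hU hX hY =>
        (contMDiffOn_const.mul hρ.contMDiffOn).mul (hg' U X Y hU hX hY), ?_⟩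
    intro e he p hp hndp a b c d
    have hm : ∀ a b, g p (coordField e a p) (coordField e b p) = metricMatrix g e p a b :=
      fun a b => rfl
    rw [kulkarniNomizuForm_apply, scalarPart,
      hρ' e he p hp hndp.conformal_factor_ne_zero]
    simp [kulkarniNomizu, metricMatrix_conformalRescaling, hm]
    ring
  · refine ⟨fun p => kulkarniNomizuForm ((1 / ((n : ℝ) - 2)) • (r p - (1 / (n : ℝ) * ρ p) •
      (ContinuousLinearMap.coeLM ℝ).comp (g p).toLinearMap))
      ((ContinuousLinearMap.coeLM ℝ).comp (g p).toLinearMap),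
      smooth_kulkarniNomizuForm hg fun U X Y hU hX hY => contMDiffOn_const.mul
        ((hr U X Y hU hX hY).sub
          ((contMDiffOn_const.mul hρ.contMDiffOn).mul (hg' U X Y hU hX hY))), ?_⟩
    intro e he p hp hndp a b c d
    have h0 := hndp.conformal_factor_ne_zero
    have hm : ∀ a b, g p (coordField e a p) (coordField e b p) = metricMatrix g e p a b :=
      fun a b => rfl
    rw [kulkarniNomizuForm_apply, semiTracelessPart, hρ' e he p hp h0]
    simp [kulkarniNomizu, metricMatrix_conformalRescaling, hm, hr' e he p hp h0, tracelessRicci]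
    ring

end

end SingularSemiRiemannian

end


open SingularSemiRiemannian in
theorem mainTheorem1 {M : Type*} [TopologicalSpace M]
    [ChartedSpace (EuclideanSpace ℝ (Fin 4)) M] [IsManifold (𝓡 4) ∞ M]
    (g : SingularSemiRiemannian.BilinField 4 M)
    (hg : SingularSemiRiemannian.IsRegularSpacetime g)
    (Ω : M → ℝ) (hΩ : ContMDiff (𝓡 4) 𝓘(ℝ, ℝ) ∞ Ω) (hdense : Dense {p : M | Ω p ≠ 0}) :
    SingularSemiRiemannian.IsQuasiRegularSpacetime
      (SingularSemiRiemannian.conformalRescaling Ω g) := by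
  have h := isQuasiRegular_conformalRescaling hg.isSingularMetric hg.nondegenerate hΩ hdense
  exact ⟨⟨h.isSemiRegular, hg.signature.rescale, h.dense_nondegenerate⟩, h⟩
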